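/- Let $k\ge 3$ be an integer and let $\mathbb F$ be any field. Let $K_n^k$ be the complete $k$-partite $k$-uniform hypergraph with vertex classes $V_1,\dots,V_k$ of size $n$ each, whose edges are all the sets containing exactly one vertex from each class. Choose an ordering $e_1,e_2,\dots,e_{n^k}$ of the edges of $K_n^k$ uniformly at random, let $G(n,m)$ be the spanning subgraph of $K_n^k$ with edges $e_1,\dots,e_m$ (so that $G(n,m)$ is uniformly distributed over the spanning subgraphs of $K_n^k$ with exactly $m$ edges), and let $$M_1=\min\{m : \text{every vertex of } G(n,m) \text{ lies in at least one edge}\}.$$ For a spanning subgraph $G$ of $K_n^k$, let $I_G$ be the incidence matrix of $G$ over $\mathbb F$: its rows are indexed by the $kn$ vertices, its columns by the edges of $G$, and $I_G[v,e]=1$ if $v\in e$ and $I_G[v,e]=0$ otherwise. Then $$\lim_{n\to\infty}\mathbb P\bigl[\operatorname{rank}_{\mathbb F} I_{G(n,M_1)}=kn-(k-1)\bigr]=1 .$$ -/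

import Mathlib

open Filter Topology

/-- The vertex set of `K_n^k`: the disjoint union of `k` classes of `n` vertices each; the vertex
`(i, a)` lies in the class `V_i`. -/
abbrev KVertex (k n : ℕ) : Type := Fin k × Fin n

/-- The edge set of `K_n^k`: an edge is a transversal, that is an element of
`V_1 × ⋯ × V_k`; its vertex in the class `V_i` is `(i, e i)`. -/
abbrev KEdge (k n : ℕ) : Type := Fin k → Fin n

namespace KEdge

/-- The edge as a set of `k` vertices. -/
def verts {k n : ℕ} (e : KEdge k n) : Finset (KVertex k n) :=
  Finset.univ.image fun i => (i, e i)

end KEdge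

/-- A (spanning) subgraph of `K_n^k`, given by its set of edges. Its vertex set is
`KVertex k n`. -/
abbrev KSubgraph (k n : ℕ) : Type := Finset (KEdge k n)

namespace KSubgraph

/-- The degree of a vertex: the number of edges that contain it. -/
def degree {k n : ℕ} (G : KSubgraph k n) (v : KVertex k n) : ℕ :=
  (G.filter fun e => v ∈ e.verts).card

/-- The minimum degree of `G` is at least `d`. -/
def MinDegreeAtLeast {k n : ℕ} (G : KSubgraph k n) (d : ℕ) : Prop :=
  ∀ v : KVertex k n, d ≤ G.degree v

/-- The incidence matrix of `G` over `F`: rows are indexed by the vertices, columns by the edges. -/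
def incidenceMatrix (F : Type*) [Field F] {k n : ℕ} (G : KSubgraph k n) :
    Matrix (KVertex k n) {e : KEdge k n // e ∈ G} F :=
  Matrix.of fun v e => if v ∈ e.1.verts then 1 else 0

end KSubgraph

/-- An outcome of the random process that adds the edges of `K_n^k` one at a time: an enumeration
of all the edges. The uniform distribution on enumerations is the process in which every new edge
is uniformly random among those not yet present. -/
abbrev EdgeOrder (k n : ℕ) : Type := Fin (Fintype.card (KEdge k n)) ≃ KEdge k n

namespace EdgeOrder

instance (k n : ℕ) : Nonempty (EdgeOrder k n) := ⟨(Fintype.equivFin (KEdge k n)).symm⟩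

/-- `G(n, m)`: the subgraph formed by the first `m` edges. -/
def graph {k n : ℕ} (σ : EdgeOrder k n) (m : ℕ) : KSubgraph k n :=
  Finset.univ.filter fun e => (σ.symm e : ℕ) < m

/-- `M_d`: the least `m` such that the minimum degree of `G(n, m)` is at least `d`. -/
noncomputable def hittingTime {k n : ℕ} (σ : EdgeOrder k n) (d : ℕ) : ℕ :=
  sInf {m : ℕ | (σ.graph m).MinDegreeAtLeast d}

end EdgeOrder

/-- The probability of an event under the uniform distribution on the enumerations of the edges of
`K_n^k`. -/
noncomputable def processProb (k n : ℕ) (A : Set (EdgeOrder k n)) : ENNReal :=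
  (PMF.uniformOfFintype (EdgeOrder k n)).toOuterMeasure A

/-! The rank is `k * n` minus the dimension of the left kernel, the space of vertex weightings with
zero sum on every edge. It suffices that, with high probability, every such weighting is constant on
each class: the k constants then sum to zero, which leaves dimension k - 1.

Let H consist of the first m ≈ (1 - 1/(4k)) n log n edges, slightly before the last isolated vertex
disappears. A kernel vector of H violated by a positive proportion of all edges was in the kernel at
every earlier stage too, so each of the m steps had a positive chance of lowering the dimension.
That dimension starts at no more than kn, far below m, so such a vector is unlikely
(`mul_prob_exists_violated_le`). Counting dimensions instead of vectors is what makes the argument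
independent of the field.

Any other kernel vector is violated by few edges. Double counting then yields an edge e₀ of zero sum
such that subtracting, class by class, the values on e₀ leaves a vector y supported on at most
n/(4k) vertices (`exists_edgeSum_eq_zero_card_deviationSet_le`). By a first moment bound, every
small nonempty set of non-isolated vertices of H is met exactly once by some edge of H
(`prob_exists_isCoveredUnexpanded_le`). An edge meeting the support of y once cannot have zero sum,
so y lives on the isolated vertices of H.

The hitting time lies between m and M ≈ 2 n log n (`prob_no_isolated_le`,
`prob_exists_isolated_le`), and no edge arriving in that window contains two isolated vertices of H
(`prob_edge_joins_isolated_le`). The edge that covers an isolated vertex therefore forces y to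
vanish there. `rank_incidenceMatrix_eq` is this deterministic argument. -/

/-! ### Uniform probability on a finite type and the second moment method -/

section UniformProbability

open Classical in
/-- The probability of an event under the uniform distribution on a finite type. -/
noncomputable def uniformProb {Ω : Type*} [Fintype Ω] (p : Ω → Prop) : ℝ :=
  ((Finset.univ.filter p).card : ℝ) / Fintype.card Ω

variable {Ω : Type*} [Fintype Ω]

theorem uniformProb_eq_card (p : Ω → Prop) [DecidablePred p] :
    uniformProb p = ((Finset.univ.filter p).card : ℝ) / Fintype.card Ω := by
  unfold uniformProb
  congr

theorem uniformProb_eq_sum (p : Ω → Prop) [DecidablePred p] :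
    uniformProb p = (∑ ω, if p ω then (1 : ℝ) else 0) / Fintype.card Ω := by
  rw [uniformProb_eq_card, Finset.sum_boole]

theorem uniformProb_nonneg (p : Ω → Prop) : 0 ≤ uniformProb p := by
  unfold uniformProb; positivity

theorem uniformProb_mono {p q : Ω → Prop} (h : ∀ ω, p ω → q ω) :
    uniformProb p ≤ uniformProb q := by
  classical
  rw [uniformProb_eq_card, uniformProb_eq_card]
  gcongr with ω
  exact h ω

theorem uniformProb_or_le (p q : Ω → Prop) :
    uniformProb (fun ω => p ω ∨ q ω) ≤ uniformProb p + uniformProb q := by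
  classical
  rw [uniformProb_eq_card, uniformProb_eq_card, uniformProb_eq_card, ← add_div]
  gcongr
  rw [Finset.filter_or]
  exact_mod_cast Finset.card_union_le _ _

theorem uniformProb_exists_mem_le {ι : Type*} (s : Finset ι) (p : ι → Ω → Prop) :
    uniformProb (fun ω => ∃ i ∈ s, p i ω) ≤ ∑ i ∈ s, uniformProb (p i) := by
  classical
  simp only [uniformProb_eq_card]
  rw [← Finset.sum_div]
  gcongr
  have : (Finset.univ.filter fun ω => ∃ i ∈ s, p i ω)
      = s.biUnion fun i => Finset.univ.filter (p i) := by
    ext ω; simp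
  rw [this]
  exact_mod_cast Finset.card_biUnion_le

theorem uniformProb_exists_mem_le_card_mul {ι : Type*} (s : Finset ι) (p : ι → Ω → Prop) {c : ℝ}
    (h : ∀ i ∈ s, uniformProb (p i) ≤ c) :
    uniformProb (fun ω => ∃ i ∈ s, p i ω) ≤ s.card * c := by
  refine (uniformProb_exists_mem_le s p).trans ?_
  simpa using Finset.sum_le_sum h

theorem uniformProb_add_not [Nonempty Ω] (p : Ω → Prop) :
    uniformProb p + uniformProb (fun ω => ¬ p ω) = 1 := by
  classical
  rw [uniformProb_eq_card, uniformProb_eq_card, ← add_div, div_eq_one_iff_eq (by positivity)]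
  have := Finset.card_filter_add_card_filter_not (s := (Finset.univ : Finset Ω)) p
  rw [Finset.card_univ] at this
  exact_mod_cast this

theorem uniformProb_true [Nonempty Ω] : uniformProb (fun _ : Ω => True) = 1 := by
  unfold uniformProb
  simp

theorem uniformProb_congr {p q : Ω → Prop} (h : ∀ ω, p ω ↔ q ω) :
    uniformProb p = uniformProb q := by
  rw [show p = q from funext fun ω => propext (h ω)]

theorem uniformProb_comp_equiv (f : Ω ≃ Ω) (p : Ω → Prop) :
    uniformProb (fun ω => p (f ω)) = uniformProb p := by
  classical
  rw [uniformProb_eq_sum, uniformProb_eq_sum]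
  congr 1
  exact Equiv.sum_comp f fun ω => if p ω then (1 : ℝ) else 0

/-- The second moment bound for a count of pairwise non-positively correlated events. -/
theorem uniformProb_forall_not_le_inv [Nonempty Ω] {ι : Type*} [DecidableEq ι] (s : Finset ι)
    (p : ι → Ω → Prop) {q : ℝ} (hpos : 0 < s.card * q) (hp : ∀ i ∈ s, uniformProb (p i) = q)
    (hpp : ∀ i ∈ s, ∀ j ∈ s, i ≠ j → uniformProb (fun ω => p i ω ∧ p j ω) ≤ q ^ 2) :
    uniformProb (fun ω => ∀ i ∈ s, ¬ p i ω) ≤ (s.card * q)⁻¹ := by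
  classical
  set c : ℝ := (Fintype.card Ω : ℝ) with hc
  have hc0 : 0 < c := by rw [hc]; positivity
  set μ : ℝ := s.card * q with hμ
  let X : Ω → ℝ := fun ω => ∑ i ∈ s, if p i ω then (1 : ℝ) else 0
  have h1 : ∑ ω, X ω = c * μ := by
    simp only [X]
    rw [Finset.sum_comm]
    have : ∀ i ∈ s, (∑ ω, if p i ω then (1 : ℝ) else 0) = c * q := by
      intro i hi
      rw [← hp i hi, uniformProb_eq_sum, hc]
      field_simp
    rw [Finset.sum_congr rfl this, Finset.sum_const, nsmul_eq_mul, hμ]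
    ring
  have h2 : ∑ ω, X ω ^ 2 ≤ c * (μ + μ ^ 2) := by
    have e1 : ∑ ω, X ω ^ 2
        = ∑ i ∈ s, ∑ j ∈ s, ∑ ω, if p i ω ∧ p j ω then (1 : ℝ) else 0 := by
      simp only [X, sq, Finset.sum_mul_sum]
      rw [Finset.sum_comm]
      refine Finset.sum_congr rfl fun i _ => ?_
      rw [Finset.sum_comm]
      refine Finset.sum_congr rfl fun j _ => Finset.sum_congr rfl fun ω _ => ?_
      by_cases hi : p i ω <;> by_cases hj : p j ω <;> simp [hi, hj]
    have e2 : ∀ i ∈ s, ∀ j ∈ s, (∑ ω, if p i ω ∧ p j ω then (1 : ℝ) else 0)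
        ≤ c * ((if i = j then q else 0) + q ^ 2) := by
      intro i hi j hj
      have : (∑ ω, if p i ω ∧ p j ω then (1 : ℝ) else 0)
          = c * uniformProb (fun ω => p i ω ∧ p j ω) := by
        rw [uniformProb_eq_sum, hc]; field_simp
      rw [this]
      gcongr
      by_cases hij : i = j
      · subst hij
        simp only [and_self, if_true, hp i hi]
        nlinarith [sq_nonneg q]
      · simpa [hij] using hpp i hi j hj hij
    rw [e1]
    refine (Finset.sum_le_sum fun i hi => Finset.sum_le_sum fun j hj => e2 i hi j hj).trans ?_
    simp only [← Finset.mul_sum, Finset.sum_add_distrib, Finset.sum_const, nsmul_eq_mul]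
    apply le_of_eq
    have : ∀ i ∈ s, (∑ j ∈ s, if i = j then q else 0) = q := by
      intro i hi; simp [hi]
    rw [Finset.sum_congr rfl this, Finset.sum_const, nsmul_eq_mul, hμ]
    ring
  have h3 : ∑ ω, (X ω - μ) ^ 2 ≤ c * μ := by
    have : ∑ ω, (X ω - μ) ^ 2 = ∑ ω, X ω ^ 2 - 2 * μ * ∑ ω, X ω + c * μ ^ 2 := by
      rw [Finset.mul_sum, ← Finset.sum_sub_distrib]
      have : c * μ ^ 2 = ∑ _ω : Ω, μ ^ 2 := by simp [hc]
      rw [this, ← Finset.sum_add_distrib]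
      exact Finset.sum_congr rfl fun ω _ => by ring
    rw [this, h1]
    nlinarith
  -- Chebyshev: where no event occurs, X = 0 and the squared deviation is μ².
  have h4 : (∑ ω, if ∀ i ∈ s, ¬ p i ω then (1 : ℝ) else 0) * μ ^ 2 ≤ ∑ ω, (X ω - μ) ^ 2 := by
    rw [Finset.sum_mul]
    refine Finset.sum_le_sum fun ω _ => ?_
    split_ifs with h
    · have : X ω = 0 := Finset.sum_eq_zero fun i hi => by simp [h i hi]
      rw [this]; simp
    · simpa using sq_nonneg _
  rw [uniformProb_eq_sum, div_le_iff₀ hc0, ← div_eq_inv_mul, le_div_iff₀ hpos]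
  have h5 := h4.trans h3
  have : ((∑ ω, if ∀ i ∈ s, ¬ p i ω then (1 : ℝ) else 0) * μ) * μ ≤ c * μ := by
    rw [sq] at h5; linarith
  exact le_of_mul_le_mul_right this hpos

end UniformProbability

/-! ### Initial segments of a random enumeration -/

section RandomOrder

variable {E : Type*} [Fintype E]

/-- The elements in the first `m` positions of an enumeration. -/
def initialSet (σ : Fin (Fintype.card E) ≃ E) (m : ℕ) : Finset E :=
  Finset.univ.filter fun e => (σ.symm e : ℕ) < m

theorem mem_initialSet {σ : Fin (Fintype.card E) ≃ E} {m : ℕ} {e : E} :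
    e ∈ initialSet σ m ↔ (σ.symm e : ℕ) < m := by
  simp [initialSet]

theorem initialSet_mono (σ : Fin (Fintype.card E) ≃ E) {m m' : ℕ} (h : m ≤ m') :
    initialSet σ m ⊆ initialSet σ m' := fun _ he =>
  mem_initialSet.2 ((mem_initialSet.1 he).trans_le h)

theorem initialSet_zero (σ : Fin (Fintype.card E) ≃ E) : initialSet σ 0 = ∅ := by
  ext e; simp [mem_initialSet]

theorem card_initialSet_le (σ : Fin (Fintype.card E) ≃ E) (m : ℕ) :
    (initialSet σ m).card ≤ m := by
  have : (initialSet σ m).card ≤ (Finset.range m).card := by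
    refine Finset.card_le_card_of_injOn (fun e => (σ.symm e : ℕ)) ?_ ?_
    · intro e he
      simpa using mem_initialSet.1 he
    · intro e _ e' _ h
      exact σ.symm.injective (Fin.ext h)
  simpa using this

theorem card_filter_le_val {N m : ℕ} :
    (Finset.univ.filter fun j : Fin N => m ≤ (j : ℕ)).card = N - m := by
  have h := Finset.card_filter_add_card_filter_not (s := (Finset.univ : Finset (Fin N)))
    fun j => (j : ℕ) < m
  simp only [not_lt, Finset.card_univ, Fintype.card_fin, Fin.card_filter_val_lt] at h
  omega

theorem initialSet_succ [DecidableEq E] (σ : Fin (Fintype.card E) ≃ E) {m : ℕ}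
    (hm : m < Fintype.card E) : initialSet σ (m + 1) = insert (σ ⟨m, hm⟩) (initialSet σ m) := by
  ext e
  rw [Finset.mem_insert, mem_initialSet, mem_initialSet, Nat.lt_succ_iff_lt_or_eq, or_comm,
    ← Equiv.symm_apply_eq, Fin.ext_iff]

theorem initialSet_swap_trans (σ : Fin (Fintype.card E) ≃ E) {m : ℕ}
    {t j : Fin (Fintype.card E)} (ht : m ≤ t) (hj : m ≤ j) :
    initialSet ((Equiv.swap t j).trans σ) m = initialSet σ m := by
  ext e
  simp only [mem_initialSet, Equiv.symm_trans_apply, Equiv.symm_swap]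
  rcases eq_or_ne (σ.symm e) t with h | h
  · rw [h, Equiv.swap_apply_left]; omega
  rcases eq_or_ne (σ.symm e) j with h' | h'
  · rw [h', Equiv.swap_apply_right]; omega
  · rw [Equiv.swap_apply_of_ne_of_ne h h']

theorem mem_initialSet_trans_swap [DecidableEq E] (σ : Fin (Fintype.card E) ≃ E) {m : ℕ}
    (a b e : E) :
    e ∈ initialSet (σ.trans (Equiv.swap a b)) m ↔ Equiv.swap a b e ∈ initialSet σ m := by
  simp [mem_initialSet]

variable [DecidableEq E]

/-- Given the first `m` elements, every later position is uniform on the remaining elements. -/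
theorem sum_prob_apply_mem {m : ℕ} {t : Fin (Fintype.card E)} (ht : m ≤ t)
    (P : Finset E → Prop) [DecidablePred P] (A : Finset E → Finset E)
    (hA : ∀ σ : Fin (Fintype.card E) ≃ E, P (initialSet σ m) →
      Disjoint (A (initialSet σ m)) (initialSet σ m)) :
    ((Fintype.card E : ℝ) - m) * (∑ σ : Fin (Fintype.card E) ≃ E,
        if P (initialSet σ m) ∧ σ t ∈ A (initialSet σ m) then (1 : ℝ) else 0)
      = ∑ σ : Fin (Fintype.card E) ≃ E,
        if P (initialSet σ m) then ((A (initialSet σ m)).card : ℝ) else 0 := by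
  have hmt : m ≤ Fintype.card E := ht.trans t.2.le
  set J := Finset.univ.filter fun j : Fin (Fintype.card E) => m ≤ (j : ℕ) with hJ
  have hJc : (J.card : ℝ) = (Fintype.card E : ℝ) - m := by
    rw [hJ, card_filter_le_val, Nat.cast_sub hmt]
  have h1 : ∀ j ∈ J, (∑ σ : Fin (Fintype.card E) ≃ E,
        if P (initialSet σ m) ∧ σ t ∈ A (initialSet σ m) then (1 : ℝ) else 0)
      = ∑ σ : Fin (Fintype.card E) ≃ E,
        if P (initialSet σ m) ∧ σ j ∈ A (initialSet σ m) then (1 : ℝ) else 0 := by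
    intro j hj
    have hj' : m ≤ (j : ℕ) := by simpa [hJ] using hj
    refine Fintype.sum_bijective (fun σ => (Equiv.swap t j).trans σ) ?_ _ _ ?_
    · exact Function.Involutive.bijective fun σ => by ext; simp
    · intro σ
      simp [initialSet_swap_trans σ ht hj']
  rw [← hJc, ← nsmul_eq_mul, ← Finset.sum_const, Finset.sum_congr rfl h1, Finset.sum_comm]
  refine Finset.sum_congr rfl fun σ _ => ?_
  split_ifs with hP
  · simp only [hP, true_and]
    rw [Finset.sum_boole]
    congr 1
    refine Finset.card_bij (fun j _ => σ j) ?_ ?_ ?_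
    · intro j hj; exact (Finset.mem_filter.1 hj).2
    · intro j _ j' _ h; exact σ.injective h
    · intro e he
      have : e ∉ initialSet σ m := Finset.disjoint_left.1 (hA σ hP) he
      refine ⟨σ.symm e, ?_, by simp⟩
      simpa [hJ, mem_initialSet, he] using this
  · simp [hP]

theorem prob_apply_mem_eq {m : ℕ} {t : Fin (Fintype.card E)} (ht : m ≤ t)
    (P : Finset E → Prop) (A : Finset E)
    (hA : ∀ σ : Fin (Fintype.card E) ≃ E, P (initialSet σ m) →
      Disjoint A (initialSet σ m)) :
    ((Fintype.card E : ℝ) - m) * uniformProb (fun σ : Fin (Fintype.card E) ≃ E =>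
        P (initialSet σ m) ∧ σ t ∈ A)
      = A.card * uniformProb (fun σ : Fin (Fintype.card E) ≃ E => P (initialSet σ m)) := by
  classical
  rw [uniformProb_eq_sum, uniformProb_eq_sum, ← mul_div_assoc, ← mul_div_assoc,
    sum_prob_apply_mem ht P (fun _ => A) hA, Finset.mul_sum]
  simp

theorem prob_disjoint_initialSet_succ {m : ℕ} (hm : m < Fintype.card E) (A : Finset E) :
    ((Fintype.card E : ℝ) - m) * uniformProb (fun σ : Fin (Fintype.card E) ≃ E =>
        Disjoint A (initialSet σ (m + 1)))
      = ((Fintype.card E : ℝ) - A.card - m) * uniformProb (fun σ : Fin (Fintype.card E) ≃ E =>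
        Disjoint A (initialSet σ m)) := by
  classical
  have hev : ∀ σ : Fin (Fintype.card E) ≃ E, Disjoint A (initialSet σ (m + 1)) ↔
      Disjoint A (initialSet σ m) ∧ σ ⟨m, hm⟩ ∉ A := by
    intro σ
    rw [initialSet_succ σ hm, Finset.disjoint_insert_right, and_comm]
  have h1 := prob_apply_mem_eq (E := E) (t := ⟨m, hm⟩) le_rfl (fun H => Disjoint A H) A
    (fun σ h => h)
  have h2 : uniformProb (fun σ : Fin (Fintype.card E) ≃ E => Disjoint A (initialSet σ m))
      = uniformProb (fun σ : Fin (Fintype.card E) ≃ E =>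
          Disjoint A (initialSet σ m) ∧ σ ⟨m, hm⟩ ∈ A)
        + uniformProb (fun σ : Fin (Fintype.card E) ≃ E => Disjoint A (initialSet σ (m + 1))) := by
    simp only [uniformProb_eq_sum, ← add_div, ← Finset.sum_add_distrib, hev]
    congr 1
    refine Finset.sum_congr rfl fun σ _ => ?_
    by_cases h : Disjoint A (initialSet σ m) <;> by_cases h' : σ ⟨m, hm⟩ ∈ A <;> simp [h, h']
  linear_combination -((Fintype.card E : ℝ) - m) * h2 - h1

/-- Reveal the positions one at a time. The exact product, not merely an upper bound, is needed to
compare pair and single probabilities in the second moment argument. -/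
theorem prob_disjoint_initialSet {m : ℕ} (hm : m ≤ Fintype.card E) (A : Finset E) :
    uniformProb (fun σ : Fin (Fintype.card E) ≃ E => Disjoint A (initialSet σ m))
      = ∏ j ∈ Finset.range m,
        (((Fintype.card E : ℝ) - A.card - j) / ((Fintype.card E : ℝ) - j)) := by
  induction m with
  | zero =>
    have : Nonempty (Fin (Fintype.card E) ≃ E) := ⟨(Fintype.equivFin E).symm⟩
    simp only [initialSet_zero, Finset.disjoint_empty_right, Finset.range_zero,
      Finset.prod_empty, uniformProb_true]
  | succ m ih =>
    have hm' : m < Fintype.card E := hm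
    have hpos : (0 : ℝ) < (Fintype.card E : ℝ) - m := by
      rw [sub_pos]; exact_mod_cast hm'
    rw [Finset.prod_range_succ, ← ih hm'.le, mul_div_assoc', eq_div_iff hpos.ne']
    linear_combination prob_disjoint_initialSet_succ hm' A

/-- Each step contributes a factor 1 - |A|/(N - m) ≤ 1 - |A|/N ≤ exp(-|A|/N), where N is the size of
E. -/
theorem prob_disjoint_initialSet_le_exp {m : ℕ} (hm : m ≤ Fintype.card E) (A : Finset E) :
    uniformProb (fun σ : Fin (Fintype.card E) ≃ E => Disjoint A (initialSet σ m))
      ≤ Real.exp (-(A.card * m / Fintype.card E)) := by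
  induction m with
  | zero =>
    have : Nonempty (Fin (Fintype.card E) ≃ E) := ⟨(Fintype.equivFin E).symm⟩
    simp only [initialSet_zero, Finset.disjoint_empty_right, uniformProb_true]
    simp
  | succ m ih =>
    have hm' : m < Fintype.card E := hm
    have hpos : (0 : ℝ) < (Fintype.card E : ℝ) - m := by
      rw [sub_pos]; exact_mod_cast hm'
    set N : ℝ := (Fintype.card E : ℝ) with hN
    have hNpos : (0 : ℝ) < N := by linarith [(Nat.cast_nonneg m : (0 : ℝ) ≤ m)]
    have h := prob_disjoint_initialSet_succ hm' A
    have h0 := uniformProb_nonneg fun σ : Fin (Fintype.card E) ≃ E =>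
      Disjoint A (initialSet σ m)
    have hfac : (N - A.card - m) / (N - m) ≤ Real.exp (-(A.card / N)) := by
      refine le_trans ?_ (Real.add_one_le_exp _)
      rw [div_le_iff₀ hpos]
      have : (A.card : ℝ) / N * (N - m) ≤ A.card := by
        rw [div_mul_eq_mul_div, div_le_iff₀ hNpos]
        have := (Nat.cast_nonneg m : (0 : ℝ) ≤ m)
        have := (Nat.cast_nonneg A.card : (0 : ℝ) ≤ A.card)
        nlinarith
      linarith
    have e1 : uniformProb (fun σ : Fin (Fintype.card E) ≃ E => Disjoint A (initialSet σ (m + 1)))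
        = (N - A.card - m) / (N - m) * uniformProb (fun σ : Fin (Fintype.card E) ≃ E =>
          Disjoint A (initialSet σ m)) := by
      rw [div_mul_eq_mul_div, eq_div_iff hpos.ne', ← h]; ring
    rw [e1]
    calc _ ≤ Real.exp (-(A.card / N)) * Real.exp (-(A.card * m / N)) :=
          mul_le_mul hfac (ih hm'.le) h0 (Real.exp_pos _).le
      _ = _ := by
          rw [← Real.exp_add]; congr 1; push_cast; field_simp; ring

/-- By symmetry e may be replaced by any element outside A ∪ B. Summing over all of these counts
elements of the initial segment, of which there are at most m. -/
theorem prob_insert_subset_le {m : ℕ} (A B : Finset E) {e : E} (heA : e ∉ A) (heB : e ∉ B)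
    (hAB : Disjoint A B) :
    ((Fintype.card E : ℝ) - A.card - B.card) * uniformProb (fun σ : Fin (Fintype.card E) ≃ E =>
        insert e B ⊆ initialSet σ m ∧ Disjoint A (initialSet σ m))
      ≤ m * uniformProb (fun σ : Fin (Fintype.card E) ≃ E =>
        B ⊆ initialSet σ m ∧ Disjoint A (initialSet σ m)) := by
  classical
  have hcard : (((A ∪ B)ᶜ).card : ℝ) = (Fintype.card E : ℝ) - A.card - B.card := by
    have := Finset.card_add_card_compl (A ∪ B)
    rw [Finset.card_union_of_disjoint hAB] at this
    have h2 : ((A.card : ℝ) + B.card) + ((A ∪ B)ᶜ).card = Fintype.card E := by exact_mod_cast this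
    linarith
  have hsym : ∀ e' ∈ (A ∪ B)ᶜ, uniformProb (fun σ : Fin (Fintype.card E) ≃ E =>
        insert e B ⊆ initialSet σ m ∧ Disjoint A (initialSet σ m))
      = uniformProb (fun σ : Fin (Fintype.card E) ≃ E =>
        insert e' B ⊆ initialSet σ m ∧ Disjoint A (initialSet σ m)) := by
    intro e' he'
    simp only [Finset.mem_compl, Finset.mem_union, not_or] at he'
    let f : (Fin (Fintype.card E) ≃ E) ≃ (Fin (Fintype.card E) ≃ E) :=
      Function.Involutive.toPerm (fun σ => σ.trans (Equiv.swap e e')) fun σ => by ext; simp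
    rw [← uniformProb_comp_equiv f]
    refine uniformProb_congr fun σ => ?_
    have hmem : ∀ x, x ∈ initialSet (f σ) m ↔ Equiv.swap e e' x ∈ initialSet σ m :=
      fun x => mem_initialSet_trans_swap σ e e' x
    have hfix : ∀ C : Finset E, e ∉ C → e' ∉ C → ∀ x ∈ C, Equiv.swap e e' x = x :=
      fun C h h' x hx => Equiv.swap_apply_of_ne_of_ne (fun hh => h (hh ▸ hx))
        (fun hh => h' (hh ▸ hx))
    rw [Finset.insert_subset_iff, Finset.insert_subset_iff, hmem, Equiv.swap_apply_left]
    simp only [Finset.subset_iff, Finset.disjoint_left, hmem]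
    refine and_congr (and_congr Iff.rfl ?_) ?_
    · exact forall₂_congr fun x hx => by rw [hfix B heB he'.2 x hx]
    · exact forall₂_congr fun x hx => by rw [hfix A heA he'.1 x hx]
  rw [← hcard, ← nsmul_eq_mul, ← Finset.sum_const, Finset.sum_congr rfl hsym]
  simp only [uniformProb_eq_sum]
  rw [← Finset.sum_div, mul_div_assoc']
  gcongr
  rw [Finset.sum_comm, Finset.mul_sum]
  refine Finset.sum_le_sum fun σ _ => ?_
  by_cases h : B ⊆ initialSet σ m ∧ Disjoint A (initialSet σ m)
  · rw [if_pos h, mul_one, Finset.sum_boole]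
    have : ((((A ∪ B)ᶜ).filter fun e' => insert e' B ⊆ initialSet σ m ∧
        Disjoint A (initialSet σ m)).card : ℝ) ≤ (initialSet σ m).card := by
      norm_cast
      refine Finset.card_le_card fun x hx => ?_
      exact (Finset.mem_filter.1 hx).2.1 (Finset.mem_insert_self _ _)
    exact this.trans (by exact_mod_cast card_initialSet_le σ m)
  · rw [if_neg h, mul_zero]
    refine (Finset.sum_eq_zero fun x _ => if_neg fun hx => h ⟨?_, hx.2⟩).le
    exact (Finset.subset_insert _ _).trans hx.1

/-- Insert the elements of B one by one; the size condition makes every factor m/(N - |A| - |B|) at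
most 2m/N. -/
theorem prob_subset_disjoint_le {m : ℕ} (hm : m ≤ Fintype.card E) (A B : Finset E)
    (hAB : Disjoint A B) (hc : 2 * (A.card + B.card) ≤ Fintype.card E) :
    uniformProb (fun σ : Fin (Fintype.card E) ≃ E =>
        B ⊆ initialSet σ m ∧ Disjoint A (initialSet σ m))
      ≤ (2 * m / Fintype.card E) ^ B.card * Real.exp (-(A.card * m / Fintype.card E)) := by
  induction B using Finset.induction_on with
  | empty => simpa using prob_disjoint_initialSet_le_exp hm A
  | insert e B he ih =>
    rw [Finset.disjoint_insert_right] at hAB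
    rw [Finset.card_insert_of_notMem he] at hc ⊢
    have h1 := prob_insert_subset_le (m := m) A B hAB.1 he hAB.2
    have h2 := ih hAB.2 (by omega)
    set p := uniformProb (fun σ : Fin (Fintype.card E) ≃ E =>
        insert e B ⊆ initialSet σ m ∧ Disjoint A (initialSet σ m)) with hp
    have hp0 : 0 ≤ p := uniformProb_nonneg _
    have hc' : 2 * ((A.card : ℝ) + (B.card + 1)) ≤ Fintype.card E := by exact_mod_cast hc
    set N : ℝ := (Fintype.card E : ℝ)
    have hN : 0 < N := by
      have : (0 : ℝ) ≤ A.card := by positivity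
      have : (0 : ℝ) ≤ B.card := by positivity
      linarith
    have h3 : N / 2 * p ≤ m * ((2 * m / N) ^ B.card * Real.exp (-(A.card * m / N))) := by
      calc N / 2 * p ≤ (N - A.card - B.card) * p := by gcongr; linarith
        _ ≤ _ := h1
        _ ≤ _ := by gcongr
    have h4 : p = (2 / N) * (N / 2 * p) := by field_simp
    rw [h4]
    calc _ ≤ (2 / N) * (m * ((2 * m / N) ^ B.card * Real.exp (-(A.card * m / N)))) := by gcongr
      _ = _ := by rw [pow_succ]; ring

end RandomOrder

/-! ### Counting edges by their intersection with a vertex set -/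

section Counting

variable {k n : ℕ}

theorem KEdge.mem_verts {e : KEdge k n} {v : KVertex k n} : v ∈ e.verts ↔ e v.1 = v.2 := by
  obtain ⟨i, a⟩ := v
  simp [KEdge.verts]

theorem card_kEdge : Fintype.card (KEdge k n) = n ^ k := by simp

theorem card_kVertex : Fintype.card (KVertex k n) = k * n := by simp

theorem card_edges_of_vertex (v : KVertex k n) :
    (Finset.univ.filter fun e : KEdge k n => v ∈ e.verts).card = n ^ (k - 1) := by
  have : (Finset.univ.filter fun e : KEdge k n => v ∈ e.verts)
      = Fintype.piFinset fun l => if l = v.1 then {v.2} else Finset.univ := by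
    ext e
    simp only [Finset.mem_filter, Finset.mem_univ, true_and, KEdge.mem_verts,
      Fintype.mem_piFinset]
    constructor
    · intro h l
      split_ifs with hl
      · subst hl; simpa using h
      · simp
    · intro h; simpa using h v.1
  rw [this, Fintype.card_piFinset]
  simp [apply_ite Finset.card, Finset.prod_ite, Finset.filter_ne']

theorem card_edges_of_pair_le {v w : KVertex k n} (h : v ≠ w) :
    (Finset.univ.filter fun e : KEdge k n => v ∈ e.verts ∧ w ∈ e.verts).card
      ≤ n ^ (k - 2) := by
  by_cases hvw : v.1 = w.1
  · have : (Finset.univ.filter fun e : KEdge k n => v ∈ e.verts ∧ w ∈ e.verts) = ∅ := by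
      refine Finset.filter_eq_empty_iff.2 fun e _ he => h ?_
      rw [KEdge.mem_verts, KEdge.mem_verts] at he
      exact Prod.ext hvw (by rw [← he.1, ← he.2, hvw])
    simp [this]
  have : (Finset.univ.filter fun e : KEdge k n => v ∈ e.verts ∧ w ∈ e.verts)
      ⊆ Fintype.piFinset fun l =>
        if l = v.1 then {v.2} else if l = w.1 then {w.2} else Finset.univ := by
    intro e
    simp only [Finset.mem_filter, Finset.mem_univ, true_and, KEdge.mem_verts,
      Fintype.mem_piFinset]
    rintro ⟨h, h'⟩ l
    split_ifs with hl hl'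
    · subst hl; simpa using h
    · subst hl'; simpa using h'
    · simp
  refine (Finset.card_le_card this).trans ?_
  rw [Fintype.card_piFinset]
  have h3 : ((Finset.univ.filter fun l : Fin k => ¬ l = v.1).filter
      fun l => ¬ l = w.1).card = k - 2 := by
    have : ((Finset.univ.filter fun l : Fin k => ¬ l = v.1).filter fun l => ¬ l = w.1)
        = (Finset.univ.erase v.1).erase w.1 := by
      ext; simp [and_comm]
    rw [this, Finset.card_erase_of_mem (by simp [Ne.symm hvw]),
      Finset.card_erase_of_mem (Finset.mem_univ _)]
    simp; omega
  simp [apply_ite Finset.card, Finset.prod_ite, h3]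

theorem sum_card_inter_verts (S : Finset (KVertex k n)) :
    ∑ e : KEdge k n, (S ∩ e.verts).card = S.card * n ^ (k - 1) := by
  have : ∀ e : KEdge k n, (S ∩ e.verts).card = ∑ v ∈ S, if v ∈ e.verts then 1 else 0 := by
    intro e
    rw [← Finset.filter_mem_eq_inter, Finset.card_filter]
  simp only [this]
  rw [Finset.sum_comm]
  simp only [← Finset.card_filter, card_edges_of_vertex, Finset.sum_const, smul_eq_mul]

theorem sum_card_offDiag_inter_verts_le (S : Finset (KVertex k n)) :
    ∑ e : KEdge k n, (S ∩ e.verts).offDiag.card ≤ S.card ^ 2 * n ^ (k - 2) := by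
  have : ∀ e : KEdge k n, (S ∩ e.verts).offDiag.card
      = ∑ p ∈ S.offDiag, if p.1 ∈ e.verts ∧ p.2 ∈ e.verts then 1 else 0 := by
    intro e
    rw [← Finset.card_filter]
    congr 1
    ext p
    simp only [Finset.mem_offDiag, Finset.mem_inter, Finset.mem_filter]
    tauto
  simp only [this]
  rw [Finset.sum_comm]
  simp only [← Finset.card_filter]
  calc _ ≤ ∑ p ∈ S.offDiag, n ^ (k - 2) := Finset.sum_le_sum fun p hp =>
        card_edges_of_pair_le (Finset.mem_offDiag.1 hp).2.2
    _ ≤ _ := by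
        rw [Finset.sum_const, smul_eq_mul, Finset.offDiag_card, sq]
        gcongr
        omega

/-- The edges of the complete hypergraph that meet `S` in exactly one vertex. -/
def edgesMeetingOnce (S : Finset (KVertex k n)) : Finset (KEdge k n) :=
  Finset.univ.filter fun e => (S ∩ e.verts).card = 1

/-- The edges of the complete hypergraph that meet `S` in at least two vertices. -/
def edgesMeetingTwice (S : Finset (KVertex k n)) : Finset (KEdge k n) :=
  Finset.univ.filter fun e => 2 ≤ (S ∩ e.verts).card

theorem card_edgesMeetingTwice_le (S : Finset (KVertex k n)) :
    (edgesMeetingTwice S).card ≤ S.card ^ 2 * n ^ (k - 2) := by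
  refine le_trans ?_ (sum_card_offDiag_inter_verts_le S)
  rw [edgesMeetingTwice, Finset.card_filter]
  refine Finset.sum_le_sum fun e _ => ?_
  split_ifs with h
  · rw [Finset.offDiag_card]
    have := Nat.mul_le_mul_right (S ∩ e.verts).card h
    omega
  · exact Nat.zero_le _

theorem card_edgesMeetingOnce_le (S : Finset (KVertex k n)) :
    (edgesMeetingOnce S).card ≤ S.card * n ^ (k - 1) := by
  rw [← sum_card_inter_verts, edgesMeetingOnce, Finset.card_filter]
  refine Finset.sum_le_sum fun e _ => ?_
  split_ifs with h <;> omega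

/-- With t = |S ∩ e|, the pointwise inequality t ≤ 1[t = 1] + t(t - 1) is summed over all edges. -/
theorem le_card_edgesMeetingOnce (S : Finset (KVertex k n)) :
    S.card * n ^ (k - 1) ≤ (edgesMeetingOnce S).card + S.card ^ 2 * n ^ (k - 2) := by
  refine le_trans ?_ (Nat.add_le_add_left (sum_card_offDiag_inter_verts_le S) _)
  rw [← sum_card_inter_verts, edgesMeetingOnce, Finset.card_filter, ← Finset.sum_add_distrib]
  refine Finset.sum_le_sum fun e _ => ?_
  rw [Finset.offDiag_card]
  split_ifs with h
  · omega
  · rcases Nat.lt_or_ge (S ∩ e.verts).card 2 with h2 | h2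
    · omega
    · have := Nat.mul_le_mul_right (S ∩ e.verts).card h2
      omega

end Counting

/-! ### The left kernel and the deterministic argument -/

section LeftKernel

variable {k n : ℕ} {F : Type*} [Field F]

/-- The sum of a vertex weighting over the vertices of an edge. -/
def edgeSum (x : KVertex k n → F) (e : KEdge k n) : F := ∑ i, x (i, e i)

variable (F) in
/-- The vertex weightings that sum to zero on every edge of `G`: the left kernel of the incidence
matrix. -/
def leftKernel (G : KSubgraph k n) : Submodule F (KVertex k n → F) where
  carrier := {x | ∀ e ∈ G, edgeSum x e = 0}
  zero_mem' := fun e _ => by simp [edgeSum]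
  add_mem' := fun {x y} hx hy e he => by
    have h1 := hx e he
    have h2 := hy e he
    simp only [edgeSum] at h1 h2 ⊢
    simp [Finset.sum_add_distrib, h1, h2]
  smul_mem' := fun c x hx e he => by
    have h1 := hx e he
    simp only [edgeSum] at h1 ⊢
    simp [← Finset.mul_sum, h1]

theorem mem_leftKernel {G : KSubgraph k n} {x : KVertex k n → F} :
    x ∈ leftKernel F G ↔ ∀ e ∈ G, edgeSum x e = 0 := Iff.rfl

theorem leftKernel_anti {G H : KSubgraph k n} (h : H ⊆ G) : leftKernel F G ≤ leftKernel F H :=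
  fun _ hx e he => hx e (h he)

theorem sum_mul_indicator_verts (x : KVertex k n → F) (e : KEdge k n) :
    ∑ v, (if v ∈ e.verts then 1 else 0) * x v = edgeSum x e := by
  rw [Fintype.sum_prod_type, edgeSum]
  refine Finset.sum_congr rfl fun i _ => ?_
  simp [KEdge.mem_verts]

/-- Rank-nullity for the transposed incidence matrix. -/
theorem rank_incidenceMatrix_add_finrank_leftKernel (G : KSubgraph k n) :
    (G.incidenceMatrix F).rank + Module.finrank F (leftKernel F G) = k * n := by
  rw [← Matrix.rank_transpose, Matrix.rank]
  have hker : leftKernel F G = LinearMap.ker (G.incidenceMatrix F).transpose.mulVecLin := by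
    ext x
    rw [LinearMap.mem_ker, mem_leftKernel, funext_iff]
    simp only [Matrix.mulVecLin_apply, Matrix.mulVec, dotProduct, Matrix.transpose_apply,
      KSubgraph.incidenceMatrix, Matrix.of_apply, sum_mul_indicator_verts, Subtype.forall,
      Pi.zero_apply]
  rw [hker, LinearMap.finrank_range_add_finrank_ker, Module.finrank_fintype_fun_eq_card,
    card_kVertex]

/-- If the left kernel consists of weightings that are constant on every class, with constants
summing to zero, then its dimension is `k - 1`. -/
theorem finrank_leftKernel_of_classwise_constant (hk : 0 < k) (hn : 0 < n) (G : KSubgraph k n)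
    (h : ∀ x ∈ leftKernel F G, ∃ c : Fin k → F, ∑ i, c i = 0 ∧ x = fun v => c v.1) :
    Module.finrank F (leftKernel F G) + 1 = k := by
  let s : (Fin k → F) →ₗ[F] F := ∑ i, LinearMap.proj i
  have hs : ∀ c, s c = ∑ i, c i := fun c => by simp [s]
  let f : (Fin k → F) →ₗ[F] (KVertex k n → F) := LinearMap.funLeft F F Prod.fst
  have hinj : Function.Injective f := by
    intro c d hcd
    ext i
    exact congrFun hcd (i, ⟨0, hn⟩)
  have hmap : leftKernel F G = (LinearMap.ker s).map f := by
    ext x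
    rw [Submodule.mem_map]
    constructor
    · intro hx
      obtain ⟨c, hc, rfl⟩ := h x hx
      exact ⟨c, by rw [LinearMap.mem_ker, hs, hc], rfl⟩
    · rintro ⟨c, hc, rfl⟩ e _
      rw [LinearMap.mem_ker, hs] at hc
      exact hc
  rw [hmap, ← (Submodule.equivMapOfInjective f hinj (LinearMap.ker s)).finrank_eq]
  have hsurj : LinearMap.range s = ⊤ := by
    rw [LinearMap.range_eq_top]
    intro a
    refine ⟨Pi.single ⟨0, hk⟩ a, ?_⟩
    rw [hs, Finset.sum_pi_single']
    simp
  have := LinearMap.finrank_range_add_finrank_ker s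
  rw [hsurj, finrank_top, Module.finrank_self, Module.finrank_fintype_fun_eq_card,
    Fintype.card_fin] at this
  omega

open Classical in
/-- The edges on which the weighting `x` does not sum to zero. -/
noncomputable def violatedEdges (x : KVertex k n → F) : Finset (KEdge k n) :=
  Finset.univ.filter fun e => edgeSum x e ≠ 0

theorem mem_violatedEdges {x : KVertex k n → F} {e : KEdge k n} :
    e ∈ violatedEdges x ↔ edgeSum x e ≠ 0 := by simp [violatedEdges]

open Classical in
/-- The vertices at which `x` differs from its value at the vertex of `e` in the same class. -/
noncomputable def deviationSet (x : KVertex k n → F) (e : KEdge k n) : Finset (KVertex k n) :=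
  Finset.univ.filter fun v => x v ≠ x (v.1, e v.1)

theorem edgeSum_update (x : KVertex k n → F) (e : KEdge k n) (i : Fin k) (a : Fin n) :
    edgeSum x (Function.update e i a) + x (i, e i) = edgeSum x e + x (i, a) := by
  unfold edgeSum
  rw [← Finset.add_sum_erase _ _ (Finset.mem_univ i),
    ← Finset.add_sum_erase (Finset.univ : Finset (Fin k)) (fun i => x (i, e i))
      (Finset.mem_univ i)]
  have : ∑ j ∈ Finset.univ.erase i, x (j, Function.update e i a j)
      = ∑ j ∈ Finset.univ.erase i, x (j, e j) :=
    Finset.sum_congr rfl fun j hj => by rw [Function.update_of_ne (Finset.ne_of_mem_erase hj)]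
  rw [this, Function.update_self]
  ring

/-- The map (e, a) ↦ (e with its i-th vertex replaced by a, old i-th vertex) is an involution, so
the updated edge is equidistributed with e. -/
theorem sum_indicator_update_eq (B : Finset (KEdge k n)) (i : Fin k) :
    ∑ e : KEdge k n, ∑ a : Fin n, (if Function.update e i a ∈ B then 1 else 0)
      = n * B.card := by
  rw [← Fintype.sum_prod_type' (f := fun (e : KEdge k n) (a : Fin n) =>
    if Function.update e i a ∈ B then 1 else 0)]
  have : ∑ p : KEdge k n × Fin n, (if Function.update p.1 i p.2 ∈ B then 1 else 0)
      = ∑ p : KEdge k n × Fin n, (if p.1 ∈ B then 1 else 0) := by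
    refine Fintype.sum_bijective
      (fun p : KEdge k n × Fin n => (Function.update p.1 i p.2, p.1 i)) ?_ _ _ fun p => rfl
    exact Function.Involutive.bijective fun p => by simp
  rw [this, Fintype.sum_prod_type, Finset.sum_comm]
  simp only [← Finset.card_filter, Finset.filter_univ_mem, Finset.sum_const, Finset.card_univ,
    Fintype.card_fin, smul_eq_mul]

/-- Replacing a vertex of a zero-sum edge by one of different weight in the same class gives a
violated edge; in each class a violated edge arises this way at most n times. -/
theorem sum_card_deviationSet_le (x : KVertex k n → F) :
    ∑ e ∈ (violatedEdges x)ᶜ, (deviationSet x e).card ≤ k * (n * (violatedEdges x).card) := by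
  classical
  calc ∑ e ∈ (violatedEdges x)ᶜ, (deviationSet x e).card
      ≤ ∑ e ∈ (violatedEdges x)ᶜ, ∑ i, ∑ a,
          (if Function.update e i a ∈ violatedEdges x then 1 else 0) := by
        refine Finset.sum_le_sum fun e he => ?_
        rw [Finset.mem_compl, mem_violatedEdges, not_not] at he
        rw [deviationSet, Finset.card_filter, Fintype.sum_prod_type]
        refine Finset.sum_le_sum fun i _ => Finset.sum_le_sum fun a _ => ?_
        have h := edgeSum_update x e i a
        by_cases h1 : x (i, a) = x (i, e i)
        · simp [h1]
        · rw [if_pos h1, if_pos]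
          rw [mem_violatedEdges]
          intro h0
          rw [h0, he, zero_add, zero_add] at h
          exact h1 h.symm
    _ ≤ ∑ e, ∑ i, ∑ a, (if Function.update e i a ∈ violatedEdges x then 1 else 0) :=
        Finset.sum_le_sum_of_subset (Finset.subset_univ _)
    _ = k * (n * (violatedEdges x).card) := by
        rw [Finset.sum_comm]
        simp only [sum_indicator_update_eq, Finset.sum_const, Finset.card_univ, Fintype.card_fin,
          smul_eq_mul]

/-- A weighting that vanishes on almost all edges is almost constant on the classes. -/
theorem exists_edgeSum_eq_zero_card_deviationSet_le (hk : 0 < k) (hn : 0 < n)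
    (x : KVertex k n → F) (h : 8 * k ^ 2 * (violatedEdges x).card ≤ n ^ k) :
    ∃ e, edgeSum x e = 0 ∧ 4 * k * (deviationSet x e).card ≤ n := by
  by_contra! hcon
  set B := violatedEdges x with hB
  have hN : 0 < n ^ k := pow_pos hn k
  have hcompl : B.card + Bᶜ.card = n ^ k := by
    rw [Finset.card_add_card_compl, card_kEdge]
  have hB2 : 2 * B.card ≤ n ^ k := by
    refine le_trans (Nat.mul_le_mul_right _ ?_) h
    nlinarith [Nat.one_le_pow 2 k hk]
  -- If all deviation sets exceeded n/(4k), this would give |Bᶜ| < 4k²|B|. But |Bᶜ| ≥ n^k/2 ≥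
  -- 4k²|B|.
  have hlt : Bᶜ.card * n < 4 * k * (k * (n * B.card)) := by
    calc Bᶜ.card * n = ∑ e ∈ Bᶜ, n := by simp
      _ < ∑ e ∈ Bᶜ, 4 * k * (deviationSet x e).card := by
          refine Finset.sum_lt_sum_of_nonempty ?_ fun e he => hcon e ?_
          · rw [← Finset.card_pos]; omega
          · simpa [hB, mem_violatedEdges] using he
      _ = 4 * k * ∑ e ∈ Bᶜ, (deviationSet x e).card := by rw [Finset.mul_sum]
      _ ≤ _ := Nat.mul_le_mul_left _ (sum_card_deviationSet_le x)
  have h1 : Bᶜ.card < 4 * k ^ 2 * B.card := by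
    refine lt_of_mul_lt_mul_right (a := n) ?_ (Nat.zero_le _)
    calc Bᶜ.card * n < 4 * k * (k * (n * B.card)) := hlt
      _ = _ := by ring
  nlinarith

/-- The deterministic part: a stage `H` whose kernel vectors are almost constant on the classes and
which expands small sets, followed by a cover of the isolated vertices of `H` by edges with one such
vertex each, gives full rank. -/
theorem rank_incidenceMatrix_eq (hk : 0 < k) (hn : 0 < n) {G H : KSubgraph k n} (hHG : H ⊆ G)
    (h1 : ∀ x ∈ leftKernel F H, 8 * k ^ 2 * (violatedEdges x).card ≤ n ^ k)
    (h2 : ∀ S : Finset (KVertex k n), S.Nonempty → 4 * k * S.card ≤ n →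
      (∀ v ∈ S, ∃ e ∈ H, v ∈ e.verts) → ∃ e ∈ H, e ∈ edgesMeetingOnce S)
    (h3 : ∀ v, ∃ e ∈ G, v ∈ e.verts)
    (h4 : ∀ e ∈ G, ∀ v ∈ e.verts, ∀ w ∈ e.verts, (∀ e ∈ H, v ∉ e.verts) →
      (∀ e ∈ H, w ∉ e.verts) → v = w) :
    ((G.incidenceMatrix F).rank : ℤ) = (k : ℤ) * (n : ℤ) - ((k : ℤ) - 1) := by
  classical
  have hfin : Module.finrank F (leftKernel F G) + 1 = k := by
    refine finrank_leftKernel_of_classwise_constant hk hn G fun x hx => ?_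
    have hxH := leftKernel_anti hHG hx
    obtain ⟨e₀, he₀, hdev⟩ := exists_edgeSum_eq_zero_card_deviationSet_le hk hn x (h1 x hxH)
    refine ⟨fun i => x (i, e₀ i), he₀, ?_⟩
    set y : KVertex k n → F := fun v => x v - x (v.1, e₀ v.1) with hy
    have hyG : ∀ e ∈ G, edgeSum y e = 0 := by
      intro e he
      have : edgeSum y e = edgeSum x e - edgeSum x e₀ := by
        simp only [edgeSum, hy, Finset.sum_sub_distrib]
      rw [this, hx e he, he₀, sub_zero]
    -- A zero-sum edge cannot meet the support of y in a single vertex.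
    have honce : ∀ e ∈ G, ∀ v ∈ e.verts, y v ≠ 0 → ∃ w ∈ e.verts, w ≠ v ∧ y w ≠ 0 := by
      intro e he v hv hyv
      by_contra! hcon
      refine hyv ?_
      rw [← hyG e he, edgeSum, Finset.sum_eq_single v.1]
      · rw [KEdge.mem_verts.1 hv]
      · intro j _ hj
        refine hcon (j, e j) (KEdge.mem_verts.2 rfl) fun h => hj ?_
        rw [← h]
      · simp
    have hiso : ∀ v, y v ≠ 0 → ∀ e ∈ H, v ∉ e.verts := by
      let S := (deviationSet x e₀).filter fun v => ∃ e ∈ H, v ∈ e.verts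
      have hmemS : ∀ v, v ∈ S ↔ y v ≠ 0 ∧ ∃ e ∈ H, v ∈ e.verts := by
        intro v
        simp only [S, deviationSet, Finset.mem_filter, Finset.mem_univ, true_and, hy,
          sub_ne_zero]
      intro v hv e he hve
      obtain ⟨e', he', hmeet⟩ := h2 S ⟨v, (hmemS v).2 ⟨hv, e, he, hve⟩⟩
        ((Nat.mul_le_mul_left _ (Finset.card_le_card (Finset.filter_subset _ _))).trans hdev)
        fun w hw => ((hmemS w).1 hw).2
      rw [edgesMeetingOnce, Finset.mem_filter, Finset.card_eq_one] at hmeet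
      obtain ⟨-, u, hu⟩ := hmeet
      have huS : u ∈ S ∩ e'.verts := by rw [hu]; simp
      rw [Finset.mem_inter, hmemS] at huS
      obtain ⟨w, hw, hwu, hyw⟩ := honce e' (hHG he') u huS.2 huS.1.1
      -- Since e' belongs to H, none of its vertices is isolated in H, so the second support vertex
      -- w lies in S as well.
      have : w ∈ S ∩ e'.verts := Finset.mem_inter.2 ⟨(hmemS w).2 ⟨hyw, e', he', hw⟩, hw⟩
      rw [hu, Finset.mem_singleton] at this
      exact hwu this
    ext v
    by_contra hne
    have hv : y v ≠ 0 := sub_ne_zero.2 hne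
    obtain ⟨e, he, hve⟩ := h3 v
    obtain ⟨w, hw, hwv, hyw⟩ := honce e he v hve hv
    exact hwv (h4 e he w hw v hve (hiso w hyw) (hiso v hv))
  have hrank := rank_incidenceMatrix_add_finrank_leftKernel (F := F) G
  have h5 : ((G.incidenceMatrix F).rank : ℤ) + (Module.finrank F (leftKernel F G) : ℤ)
      = (k : ℤ) * n := by exact_mod_cast hrank
  have h6 : (Module.finrank F (leftKernel F G) : ℤ) + 1 = k := by exact_mod_cast hfin
  linarith

theorem finrank_leftKernel_insert_lt {G : KSubgraph k n} {x : KVertex k n → F}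
    (hx : x ∈ leftKernel F G) {e : KEdge k n} (he : e ∈ violatedEdges x) :
    Module.finrank F (leftKernel F (insert e G)) + 1 ≤ Module.finrank F (leftKernel F G) := by
  refine Submodule.finrank_lt_finrank_of_lt (lt_of_le_of_ne
    (leftKernel_anti (Finset.subset_insert e G)) fun h => ?_)
  rw [← h] at hx
  exact mem_violatedEdges.1 he (hx e (Finset.mem_insert_self _ _))

/-- It is unlikely that a kernel vector of the first `m` edges is violated by a positive proportion
of all edges, since each such stage lowers the dimension of the kernel with positive
probability. -/
theorem mul_prob_exists_violated_le (hn : 0 < n) {m : ℕ}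
    (hm : m ≤ Fintype.card (KEdge k n)) :
    m * uniformProb (fun σ : Fin (Fintype.card (KEdge k n)) ≃ KEdge k n =>
        ∃ x ∈ leftKernel F (initialSet σ m), n ^ k < 8 * k ^ 2 * (violatedEdges x).card)
      ≤ 8 * k ^ 3 * n := by
  classical
  set Ω := Fin (Fintype.card (KEdge k n)) ≃ KEdge k n
  let P : KSubgraph k n → Prop := fun H =>
    ∃ x ∈ leftKernel F H, n ^ k < 8 * k ^ 2 * (violatedEdges x).card
  -- The bad kernel vector is chosen from H alone, so the next edge is still uniform on the
  -- remaining edges once A is fixed.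
  let A : KSubgraph k n → Finset (KEdge k n) := fun H =>
    if h : P H then violatedEdges h.choose else ∅
  let r : Ω → ℕ → ℝ := fun σ t => Module.finrank F (leftKernel F (initialSet σ t))
  have : Nonempty Ω := ⟨(Fintype.equivFin _).symm⟩
  have hN : (0 : ℝ) < (n : ℝ) ^ k := by positivity
  -- Kernels only shrink, so a bad vector at stage m is already bad at stage t; the next edge then
  -- lowers the dimension with probability at least 1/(8k²).
  have hstep : ∀ t ∈ Finset.range m, (∑ σ : Ω, if P (initialSet σ m) then (1 : ℝ) else 0)
      ≤ 8 * k ^ 2 * ∑ σ : Ω, (r σ t - r σ (t + 1)) := by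
    intro t ht
    have htm : t < m := Finset.mem_range.1 ht
    have htN : t < Fintype.card (KEdge k n) := htm.trans_le hm
    have hswap := sum_prob_apply_mem (t := ⟨t, htN⟩) (m := t) le_rfl P A fun σ hσ => by
      simp only [A, dif_pos hσ]
      refine Finset.disjoint_left.2 fun e he he' => ?_
      exact mem_violatedEdges.1 he (hσ.choose_spec.1 e he')
    have hlow : (n : ℝ) ^ k * (∑ σ : Ω, if P (initialSet σ m) then (1 : ℝ) else 0)
        ≤ 8 * k ^ 2 * ∑ σ : Ω,
          if P (initialSet σ t) then ((A (initialSet σ t)).card : ℝ) else 0 := by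
      rw [Finset.mul_sum, Finset.mul_sum]
      refine Finset.sum_le_sum fun σ _ => ?_
      by_cases hP : P (initialSet σ m)
      · have hP' : P (initialSet σ t) := by
          obtain ⟨x, hx, hx'⟩ := hP
          exact ⟨x, leftKernel_anti (initialSet_mono σ htm.le) hx, hx'⟩
        rw [if_pos hP, if_pos hP', mul_one]
        simp only [A, dif_pos hP']
        exact_mod_cast hP'.choose_spec.2.le
      · rw [if_neg hP, mul_zero]
        positivity
    have hdrop : (∑ σ : Ω, if P (initialSet σ t) ∧ σ ⟨t, htN⟩ ∈ A (initialSet σ t)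
          then (1 : ℝ) else 0) ≤ ∑ σ : Ω, (r σ t - r σ (t + 1)) := by
      refine Finset.sum_le_sum fun σ _ => ?_
      simp only [r]
      rw [initialSet_succ σ htN]
      split_ifs with h
      · obtain ⟨hP, hmem⟩ := h
        simp only [A, dif_pos hP] at hmem
        have := finrank_leftKernel_insert_lt hP.choose_spec.1 hmem
        have : ((Module.finrank F (leftKernel F (insert (σ ⟨t, htN⟩) (initialSet σ t))) : ℕ) : ℝ)
          + 1 ≤ Module.finrank F (leftKernel F (initialSet σ t)) := by exact_mod_cast this
        linarith
      · have := Submodule.finrank_mono (leftKernel_anti (F := F)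
          (Finset.subset_insert (σ ⟨t, htN⟩) (initialSet σ t)))
        rw [sub_nonneg]
        exact_mod_cast this
    have hcard : (Fintype.card (KEdge k n) : ℝ) = (n : ℝ) ^ k := by rw [card_kEdge]; push_cast; rfl
    rw [← hswap, hcard] at hlow
    refine le_of_mul_le_mul_left (hlow.trans ?_) hN
    have h0 : (0 : ℝ) ≤ ∑ σ : Ω, if P (initialSet σ t) ∧ σ ⟨t, htN⟩ ∈ A (initialSet σ t)
        then (1 : ℝ) else 0 := Finset.sum_nonneg fun σ _ => by positivity
    calc _ ≤ 8 * (k : ℝ) ^ 2 * ((n : ℝ) ^ k * ∑ σ : Ω, (r σ t - r σ (t + 1))) := by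
          gcongr ?_ * ?_
          refine mul_le_mul ?_ hdrop h0 hN.le
          linarith [(Nat.cast_nonneg t : (0 : ℝ) ≤ t)]
      _ = _ := by ring
  have hsum := Finset.sum_le_sum hstep
  rw [Finset.sum_const, Finset.card_range, nsmul_eq_mul, ← Finset.mul_sum, Finset.sum_comm] at hsum
  -- The total drop telescopes and is at most the initial dimension kn.
  have htel : ∑ σ : Ω, ∑ t ∈ Finset.range m, (r σ t - r σ (t + 1))
      ≤ Fintype.card Ω * (k * n : ℝ) := by
    have hconst : Fintype.card Ω * (k * n : ℝ) = ∑ _σ : Ω, (k * n : ℝ) := by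
      rw [Finset.sum_const, nsmul_eq_mul, Finset.card_univ]
    rw [hconst]
    refine Finset.sum_le_sum fun σ _ => ?_
    rw [Finset.sum_range_sub']
    have h1 : r σ 0 ≤ (k * n : ℝ) := by
      have := Submodule.finrank_le (leftKernel F (initialSet σ 0))
      rw [Module.finrank_fintype_fun_eq_card, card_kVertex] at this
      simp only [r]
      exact_mod_cast this
    have h2 : 0 ≤ r σ m := by simp only [r]; positivity
    linarith
  have hΩ : (0 : ℝ) < Fintype.card Ω := by positivity
  rw [uniformProb_eq_sum, ← mul_div_assoc, div_le_iff₀ hΩ]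
  calc _ ≤ 8 * (k : ℝ) ^ 2 * (Fintype.card Ω * (k * n : ℝ)) := hsum.trans (by gcongr)
    _ = _ := by ring

end LeftKernel

/-! ### Isolated vertices and unexpanded sets in the random process -/

section RandomHypergraph

variable {k n : ℕ}

/-- The edges of the complete hypergraph through a vertex. -/
def edgesThrough (v : KVertex k n) : Finset (KEdge k n) :=
  Finset.univ.filter fun e => v ∈ e.verts

theorem mem_edgesThrough {v : KVertex k n} {e : KEdge k n} :
    e ∈ edgesThrough v ↔ v ∈ e.verts := by simp [edgesThrough]

theorem card_edgesThrough (v : KVertex k n) : (edgesThrough v).card = n ^ (k - 1) :=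
  card_edges_of_vertex v

theorem disjoint_edgesThrough_iff {v : KVertex k n} {G : KSubgraph k n} :
    Disjoint (edgesThrough v) G ↔ ∀ e ∈ G, v ∉ e.verts := by
  rw [Finset.disjoint_right]
  simp only [mem_edgesThrough]

theorem card_inter_edgesThrough_le {v w : KVertex k n} (h : v ≠ w) :
    (edgesThrough v ∩ edgesThrough w).card ≤ n ^ (k - 2) := by
  refine le_trans (Finset.card_le_card fun e he => ?_) (card_edges_of_pair_le h)
  simpa [mem_edgesThrough] using he

theorem le_card_union_edgesThrough {v w : KVertex k n} (h : v ≠ w) :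
    2 * n ^ (k - 1) ≤ (edgesThrough v ∪ edgesThrough w).card + n ^ (k - 2) := by
  have h1 := Finset.card_union_add_card_inter (edgesThrough v) (edgesThrough w)
  have h2 := card_inter_edgesThrough_le h
  rw [card_edgesThrough, card_edgesThrough] at h1
  omega

theorem prob_exists_isolated_le (hk : 0 < k) (hn : 0 < n) {m : ℕ}
    (hm : m ≤ Fintype.card (KEdge k n)) :
    uniformProb (fun σ : EdgeOrder k n => ∃ v : KVertex k n, ∀ e ∈ initialSet σ m, v ∉ e.verts)
      ≤ k * n * Real.exp (-(m / n)) := by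
  have h := uniformProb_exists_mem_le_card_mul (Finset.univ : Finset (KVertex k n))
    (fun v (σ : EdgeOrder k n) => Disjoint (edgesThrough v) (initialSet σ m))
    (c := Real.exp (-(m / n))) fun v _ => by
      refine (prob_disjoint_initialSet_le_exp hm _).trans_eq ?_
      rw [card_edgesThrough, card_kEdge]
      obtain ⟨l, rfl⟩ : ∃ l, k = l + 1 := ⟨k - 1, by omega⟩
      have : (n : ℝ) ≠ 0 := by positivity
      congr 1
      push_cast
      rw [pow_succ]
      field_simp
  rw [Finset.card_univ, card_kVertex] at h
  push_cast at h
  refine le_trans (uniformProb_mono ?_) h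
  rintro σ ⟨v, hv⟩
  exact ⟨v, Finset.mem_univ _, disjoint_edgesThrough_iff.2 hv⟩

/-- Union bound over at most M times and (kn)² ordered pairs. Both vertices are isolated with
probability at most exp(-(3/2)m/n), and a later edge then contains both with probability at most
n^(k-2)/(n^k - m) ≤ 2/n². -/
theorem prob_edge_joins_isolated_le (hk : 2 ≤ k) (hn : 2 ≤ n) {m M : ℕ}
    (hm : 2 * m ≤ n ^ k) :
    uniformProb (fun σ : EdgeOrder k n => ∃ t : Fin (Fintype.card (KEdge k n)),
        (m ≤ (t : ℕ) ∧ (t : ℕ) < M) ∧ ∃ v w : KVertex k n, v ≠ w ∧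
          (∀ e ∈ initialSet σ m, v ∉ e.verts) ∧ (∀ e ∈ initialSet σ m, w ∉ e.verts) ∧
          v ∈ (σ t).verts ∧ w ∈ (σ t).verts)
      ≤ 2 * k ^ 2 * M * Real.exp (-(3 / 2 * (m / n))) := by
  have hn0 : (0 : ℝ) < n := by exact_mod_cast (by omega : 0 < n)
  have hn2 : (2 : ℝ) ≤ n := by exact_mod_cast hn
  obtain ⟨l, rfl⟩ : ∃ l, k = l + 2 := ⟨k - 2, by omega⟩
  have hmN : m ≤ Fintype.card (KEdge (l + 2) n) := by rw [card_kEdge]; omega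
  set T := Finset.univ.filter fun t : Fin (Fintype.card (KEdge (l + 2) n)) =>
    m ≤ (t : ℕ) ∧ (t : ℕ) < M with hT
  set D := (Finset.univ : Finset (KVertex (l + 2) n)).offDiag with hD
  have hTc : T.card ≤ M := by
    calc T.card ≤ (Finset.univ.filter fun t : Fin (Fintype.card (KEdge (l + 2) n)) =>
          (t : ℕ) < M).card := Finset.card_le_card fun t ht => by
            simp only [hT, Finset.mem_filter] at ht ⊢; exact ⟨ht.1, ht.2.2⟩
      _ ≤ M := by rw [Fin.card_filter_val_lt]; omega
  have hDc : D.card ≤ ((l + 2) * n) ^ 2 := by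
    rw [hD, Finset.offDiag_card, Finset.card_univ, card_kVertex, sq]; omega
  have hmain := uniformProb_exists_mem_le_card_mul T
    (fun t (σ : EdgeOrder (l + 2) n) => ∃ p ∈ D,
      Disjoint (edgesThrough p.1 ∪ edgesThrough p.2) (initialSet σ m)
        ∧ σ t ∈ edgesThrough p.1 ∩ edgesThrough p.2)
    (c := D.card * (2 / n ^ 2 * Real.exp (-(3 / 2 * (m / n))))) fun t ht =>
      uniformProb_exists_mem_le_card_mul D _ fun p hp => by
        have hne : p.1 ≠ p.2 := (Finset.mem_offDiag.1 hp).2.2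
        have htm : m ≤ (t : ℕ) := by simp only [hT, Finset.mem_filter] at ht; exact ht.2.1
        have h1 := prob_apply_mem_eq htm
          (fun H => Disjoint (edgesThrough p.1 ∪ edgesThrough p.2) H)
          (edgesThrough p.1 ∩ edgesThrough p.2) fun σ h =>
            h.mono_left (Finset.inter_subset_left.trans Finset.subset_union_left)
        have h2 := prob_disjoint_initialSet_le_exp hmN (edgesThrough p.1 ∪ edgesThrough p.2)
        have h3 : Real.exp (-((edgesThrough p.1 ∪ edgesThrough p.2).card * m
            / Fintype.card (KEdge (l + 2) n))) ≤ Real.exp (-(3 / 2 * (m / n))) := by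
          have h5 : 2 * (n : ℝ) ^ (l + 1) ≤ (edgesThrough p.1 ∪ edgesThrough p.2).card + n ^ l := by
            have := le_card_union_edgesThrough hne
            simp only [Nat.add_sub_cancel, show l + 2 - 1 = l + 1 by omega] at this
            exact_mod_cast this
          have h6 : 3 / 2 * (n : ℝ) ^ (l + 1) ≤ (edgesThrough p.1 ∪ edgesThrough p.2).card := by
            have : (n : ℝ) ^ (l + 1) = n ^ l * n := pow_succ _ _
            have : (0 : ℝ) < (n : ℝ) ^ l := by positivity
            nlinarith
          rw [card_kEdge, Real.exp_le_exp, neg_le_neg_iff]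
          push_cast
          calc 3 / 2 * ((m : ℝ) / n) = (3 / 2 * (n : ℝ) ^ (l + 1)) * m / n ^ (l + 2) := by
                rw [pow_succ (n : ℝ) (l + 1)]; field_simp
            _ ≤ _ := by gcongr
        have h4 : ((edgesThrough p.1 ∩ edgesThrough p.2).card : ℝ) ≤ n ^ l := by
          have := card_inter_edgesThrough_le hne
          rw [Nat.add_sub_cancel] at this
          exact_mod_cast this
        have hmN' : (n : ℝ) ^ (l + 2) / 2
            ≤ (Fintype.card (KEdge (l + 2) n) : ℝ) - m := by
          have : 2 * (m : ℝ) ≤ (n : ℝ) ^ (l + 2) := by exact_mod_cast hm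
          rw [card_kEdge]; push_cast; linarith
        set Q := uniformProb (fun σ : EdgeOrder (l + 2) n =>
          Disjoint (edgesThrough p.1 ∪ edgesThrough p.2) (initialSet σ m)
            ∧ σ t ∈ edgesThrough p.1 ∩ edgesThrough p.2)
        have hQ : 0 ≤ Q := uniformProb_nonneg _
        have h7 : (n : ℝ) ^ (l + 2) / 2 * Q ≤ n ^ l * Real.exp (-(3 / 2 * (m / n))) := by
          calc _ ≤ ((Fintype.card (KEdge (l + 2) n) : ℝ) - m) * Q := by gcongr
            _ = _ := h1
            _ ≤ _ := mul_le_mul h4 (h2.trans h3) (uniformProb_nonneg _) (by positivity)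
        have h8 : Q = 2 / n ^ (l + 2) * ((n : ℝ) ^ (l + 2) / 2 * Q) := by field_simp
        rw [h8]
        calc _ ≤ 2 / (n : ℝ) ^ (l + 2) * (n ^ l * Real.exp (-(3 / 2 * (m / n)))) := by gcongr
          _ = _ := by rw [pow_add]; field_simp
  refine (uniformProb_mono ?_).trans (hmain.trans ?_)
  · rintro σ ⟨t, ht, v, w, hvw, hv, hw, hvt, hwt⟩
    refine ⟨t, by simpa [hT] using ht, (v, w), by simpa [hD] using hvw, ?_, ?_⟩
    · rw [Finset.disjoint_union_left]
      exact ⟨disjoint_edgesThrough_iff.2 hv, disjoint_edgesThrough_iff.2 hw⟩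
    · simp [mem_edgesThrough, hvt, hwt]
  · have hTc' : (T.card : ℝ) ≤ M := by exact_mod_cast hTc
    have hDc' : (D.card : ℝ) ≤ ((l + 2 : ℕ) * n) ^ 2 := by exact_mod_cast hDc
    calc _ ≤ (M : ℝ) * (((l + 2 : ℕ) * n) ^ 2 * (2 / n ^ 2 * Real.exp (-(3 / 2 * (m / n))))) := by
          gcongr
      _ = _ := by field_simp

/-- Second moment method on a single class: its vertices have disjoint stars, so their isolation
events are non-positively correlated. -/
theorem prob_no_isolated_le (hk : 2 ≤ k) (hn : 3 ≤ n) {m : ℕ} (hm : m ≤ n ^ (k - 1)) :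
    uniformProb (fun σ : EdgeOrder k n => ∀ v : KVertex k n, ∃ e ∈ initialSet σ m, v ∈ e.verts)
      ≤ Real.exp (m / (n - 2)) / n := by
  have hn0 : (0 : ℝ) < n := by exact_mod_cast (by omega : 0 < n)
  have hn3 : (3 : ℝ) ≤ n := by exact_mod_cast hn
  obtain ⟨l, rfl⟩ : ∃ l, k = l + 1 := ⟨k - 1, by omega⟩
  rw [Nat.add_sub_cancel] at hm
  have hmd : (m : ℝ) ≤ (n : ℝ) ^ l := by exact_mod_cast hm
  have hd : (0 : ℝ) < (n : ℝ) ^ l := by positivity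
  have hN : (Fintype.card (KEdge (l + 1) n) : ℝ) = (n : ℝ) ^ l * n := by
    rw [card_kEdge]; push_cast; ring
  have hmN : m ≤ Fintype.card (KEdge (l + 1) n) := by
    rw [card_kEdge]; exact hm.trans (Nat.pow_le_pow_right (by omega) (by omega))
  have : Nonempty (EdgeOrder (l + 1) n) := inferInstance
  set d : ℝ := (n : ℝ) ^ l with hd_def
  set q : ℝ := ∏ j ∈ Finset.range m, ((d * n - d - j) / (d * n - j)) with hq
  have hj : ∀ j ∈ Finset.range m, (j : ℝ) ≤ d := fun j hj => by
    have : (j : ℝ) ≤ m := by exact_mod_cast (Finset.mem_range.1 hj).le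
    linarith
  have hdn : 3 * d ≤ d * n := by nlinarith
  have hlow : Real.exp (-(m / (n - 2))) ≤ q := by
    have hterm : ∀ j ∈ Finset.range m,
        Real.exp (-(1 / (n - 2))) ≤ (d * n - d - j) / (d * n - j) := by
      intro j hj'
      have h1 := hj j hj'
      have h2 : 0 < d * n - d - j := by linarith
      have h3 : 0 < d * n - j := by linarith
      -- The inverse factor is 1 + d/(dn - d - j), and j ≤ d bounds the second term by 1/(n - 2).
      rw [Real.exp_neg, inv_le_comm₀ (Real.exp_pos _) (by positivity), inv_div]
      refine le_trans ?_ (Real.add_one_le_exp _)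
      have h4 : (0 : ℝ) < n - 2 := by linarith
      rw [div_le_iff₀ h2]
      have h5 : d ≤ 1 / (n - 2) * (d * n - d - j) := by
        rw [one_div, ← div_eq_inv_mul, le_div_iff₀ h4]
        nlinarith
      nlinarith
    calc Real.exp (-(m / (n - 2))) = ∏ _j ∈ Finset.range m, Real.exp (-(1 / ((n : ℝ) - 2))) := by
          rw [Finset.prod_const, Finset.card_range, ← Real.exp_nat_mul]
          congr 1
          ring
      _ ≤ q := Finset.prod_le_prod (fun _ _ => (Real.exp_pos _).le) hterm
  have hqpos : 0 < q := (Real.exp_pos _).trans_le hlow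
  have key := uniformProb_forall_not_le_inv (Finset.univ : Finset (Fin n))
    (fun a (σ : EdgeOrder (l + 1) n) =>
      Disjoint (edgesThrough ((0 : Fin (l + 1)), a)) (initialSet σ m)) (q := q)
    (by rw [Finset.card_univ, Fintype.card_fin]; positivity)
    (fun a _ => by
      rw [prob_disjoint_initialSet hmN, card_edgesThrough, hN]
      simp [hq, hd_def])
    (fun a _ b _ hab => by
      have hdis : Disjoint (edgesThrough ((0 : Fin (l + 1)), a))
          (edgesThrough ((0 : Fin (l + 1)), b)) := by
        rw [Finset.disjoint_left]
        intro e he he'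
        rw [mem_edgesThrough, KEdge.mem_verts] at he he'
        exact hab (he.symm.trans he')
      simp only [← Finset.disjoint_union_left]
      rw [prob_disjoint_initialSet hmN, Finset.card_union_of_disjoint hdis, card_edgesThrough,
        card_edgesThrough, hN, hq, ← Finset.prod_pow]
      refine Finset.prod_le_prod (fun j hj' => ?_) fun j hj' => ?_
      · have h1 := hj j hj'
        simp only [Nat.add_sub_cancel]
        push_cast
        rw [← hd_def]
        apply div_nonneg <;> linarith
      · have h1 := hj j hj'
        have h3 : 0 < d * n - j := by linarith
        simp only [Nat.add_sub_cancel]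
        push_cast
        -- With T = dn - j the comparison is (T - 2d)T ≤ (T - d)².
        rw [← hd_def, div_pow, div_le_div_iff₀ h3 (by positivity)]
        nlinarith [mul_nonneg h3.le (sq_nonneg d)])
  refine (uniformProb_mono ?_).trans (key.trans ?_)
  · intro σ h a _ hdis
    obtain ⟨e, he, hv⟩ := h (0, a)
    exact disjoint_edgesThrough_iff.1 hdis e he hv
  · rw [Finset.card_univ, Fintype.card_fin, mul_inv, mul_comm, ← div_eq_mul_inv]
    gcongr
    rw [inv_le_comm₀ hqpos (Real.exp_pos _), ← Real.exp_neg]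
    exact hlow

/-- A set of non-isolated vertices that no edge of `G` meets exactly once. -/
def IsCoveredUnexpanded (G : KSubgraph k n) (S : Finset (KVertex k n)) : Prop :=
  (∀ v ∈ S, ∃ e ∈ G, v ∈ e.verts) ∧ Disjoint (edgesMeetingOnce S) G

/-- The edges of G meeting S at least twice must cover S, and each covers at most k vertices, so
there are at least |S|/k of them. -/
theorem IsCoveredUnexpanded.exists_subset {G : KSubgraph k n} {S : Finset (KVertex k n)}
    (h : IsCoveredUnexpanded G S) {b : ℕ} (hb : k * b < S.card + k) :
    ∃ B ∈ (edgesMeetingTwice S).powersetCard b, B ⊆ G := by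
  have hcov : S ⊆ (G ∩ edgesMeetingTwice S).biUnion KEdge.verts := by
    intro v hv
    obtain ⟨e, he, hve⟩ := h.1 v hv
    refine Finset.mem_biUnion.2 ⟨e, Finset.mem_inter.2 ⟨he, ?_⟩, hve⟩
    have h1 : e ∉ edgesMeetingOnce S := fun h' => Finset.disjoint_left.1 h.2 h' he
    have h2 : 0 < (S ∩ e.verts).card := Finset.card_pos.2 ⟨v, Finset.mem_inter.2 ⟨hv, hve⟩⟩
    simp only [edgesMeetingOnce, edgesMeetingTwice, Finset.mem_filter, Finset.mem_univ,
      true_and] at h1 ⊢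
    omega
  have hcard : S.card ≤ (G ∩ edgesMeetingTwice S).card * k := by
    refine (Finset.card_le_card hcov).trans (Finset.card_biUnion_le_card_mul _ _ _ fun e _ => ?_)
    exact Finset.card_image_le.trans (by simp)
  have hbc : b ≤ (G ∩ edgesMeetingTwice S).card := by
    by_contra! hlt
    have := Nat.mul_le_mul_left k hlt
    rw [Nat.succ_eq_add_one] at this
    nlinarith
  obtain ⟨B, hB, hBc⟩ := Finset.exists_subset_card_eq hbc
  exact ⟨B, Finset.mem_powersetCard.2 ⟨hB.trans Finset.inter_subset_right, hBc⟩,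
    hB.trans Finset.inter_subset_left⟩

theorem disjoint_edgesMeetingOnce_edgesMeetingTwice (S : Finset (KVertex k n)) :
    Disjoint (edgesMeetingOnce S) (edgesMeetingTwice S) := by
  rw [Finset.disjoint_left]
  intro e h1 h2
  simp only [edgesMeetingOnce, edgesMeetingTwice, Finset.mem_filter, Finset.mem_univ,
    true_and] at h1 h2
  omega

/-- Union bound over the b edges present that meet S twice, out of at most |S|² n^(k-2). Since |S| ≤
n/(4k), nearly |S| n^(k-1) edges meet S once, and their joint absence gives the exponential. -/
theorem prob_isCoveredUnexpanded_le (hk : 2 ≤ k) (hn : 0 < n) {m : ℕ}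
    (hm : m ≤ Fintype.card (KEdge k n)) (S : Finset (KVertex k n)) (hS : 4 * k * S.card ≤ n)
    {b : ℕ} (hb : k * b < S.card + k) (hbS : b ≤ S.card) :
    uniformProb (fun σ : EdgeOrder k n => IsCoveredUnexpanded (initialSet σ m) S)
      ≤ ((S.card : ℝ) ^ 2 * (2 * m / n ^ 2)) ^ b
        * Real.exp (-(S.card * ((1 - 1 / (4 * k)) * (m / n)))) := by
  have hn0 : (0 : ℝ) < n := by exact_mod_cast hn
  obtain ⟨l, rfl⟩ : ∃ l, k = l + 2 := ⟨k - 2, by omega⟩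
  set s := S.card with hs
  have hN : (Fintype.card (KEdge (l + 2) n) : ℝ) = (n : ℝ) ^ l * n ^ 2 := by
    rw [card_kEdge]; push_cast; ring
  have hone := card_edgesMeetingOnce_le S
  have hone' := le_card_edgesMeetingOnce S
  have htwo := card_edgesMeetingTwice_le S
  rw [← hs, show l + 2 - 1 = l + 1 by omega] at hone hone'
  rw [← hs, Nat.add_sub_cancel] at htwo
  rw [Nat.add_sub_cancel] at hone'
  have hsize : 2 * ((edgesMeetingOnce S).card + b) ≤ Fintype.card (KEdge (l + 2) n) := by
    rw [card_kEdge]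
    have h1 : 1 ≤ n ^ (l + 1) := Nat.one_le_pow _ _ hn
    calc 2 * ((edgesMeetingOnce S).card + b) ≤ 2 * (s * n ^ (l + 1) + s * n ^ (l + 1)) := by
          gcongr
          exact hbS.trans (Nat.le_mul_of_pos_right _ h1)
      _ = 4 * s * n ^ (l + 1) := by ring
      _ ≤ (4 * (l + 2) * s) * n ^ (l + 1) := by gcongr; nlinarith
      _ ≤ n * n ^ (l + 1) := by gcongr
      _ = n ^ (l + 2) := by ring
  have hexp : Real.exp (-((edgesMeetingOnce S).card * m / Fintype.card (KEdge (l + 2) n)))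
      ≤ Real.exp (-(s * ((1 - 1 / (4 * (l + 2 : ℕ))) * (m / n)))) := by
    rw [Real.exp_le_exp, neg_le_neg_iff, hN, le_div_iff₀ (by positivity)]
    have h1 : (s : ℝ) * n ^ (l + 1) ≤ (edgesMeetingOnce S).card + s ^ 2 * n ^ l := by
      exact_mod_cast hone'
    have h2 : 4 * ((l + 2 : ℕ) : ℝ) * s ≤ n := by exact_mod_cast hS
    have h3 : (s : ℝ) ≤ 1 / (4 * (l + 2 : ℕ)) * n := by
      rw [one_div, ← div_eq_inv_mul, le_div_iff₀ (by positivity)]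
      linarith
    have h4 : (s : ℝ) * (1 - 1 / (4 * (l + 2 : ℕ))) * n ^ (l + 1) ≤ (edgesMeetingOnce S).card := by
      have h5 : (s : ℝ) ^ 2 * n ^ l ≤ s * (1 / (4 * (l + 2 : ℕ)) * n) * n ^ l := by
        rw [sq]; gcongr
      rw [pow_succ] at h1 ⊢
      linarith
    calc _ = (s : ℝ) * (1 - 1 / (4 * (l + 2 : ℕ))) * n ^ (l + 1) * m := by
          field_simp
          ring
      _ ≤ _ := by gcongr
  have hmain := uniformProb_exists_mem_le_card_mul ((edgesMeetingTwice S).powersetCard b)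
    (fun B (σ : EdgeOrder (l + 2) n) =>
      B ⊆ initialSet σ m ∧ Disjoint (edgesMeetingOnce S) (initialSet σ m))
    (c := (2 * m / Fintype.card (KEdge (l + 2) n)) ^ b
      * Real.exp (-(s * ((1 - 1 / (4 * (l + 2 : ℕ))) * (m / n))))) fun B hB => by
      obtain ⟨hB1, hB2⟩ := Finset.mem_powersetCard.1 hB
      have := prob_subset_disjoint_le hm (edgesMeetingOnce S) B
        ((disjoint_edgesMeetingOnce_edgesMeetingTwice S).mono_right hB1) (by rw [hB2]; exact hsize)
      rw [hB2] at this
      exact this.trans (by gcongr)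
  refine (uniformProb_mono ?_).trans (hmain.trans ?_)
  · intro σ h
    obtain ⟨B, hB, hBG⟩ := h.exists_subset hb
    exact ⟨B, hB, hBG, h.2⟩
  · rw [← mul_assoc]
    gcongr
    rw [Finset.card_powersetCard]
    have h1 : (((edgesMeetingTwice S).card.choose b : ℕ) : ℝ) ≤ ((s : ℝ) ^ 2 * n ^ l) ^ b := by
      calc (((edgesMeetingTwice S).card.choose b : ℕ) : ℝ)
          ≤ ((edgesMeetingTwice S).card : ℝ) ^ b := by exact_mod_cast Nat.choose_le_pow _ _
        _ ≤ _ := by gcongr; exact_mod_cast htwo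
    calc _ ≤ ((s : ℝ) ^ 2 * n ^ l) ^ b * (2 * m / Fintype.card (KEdge (l + 2) n)) ^ b := by gcongr
      _ = _ := by rw [← mul_pow, hN]; congr 1; field_simp

end RandomHypergraph

/-! ### Union bounds, the choice of parameters and the limit -/

section Assembly

variable {k n : ℕ}

theorem choose_le_exp_mul_div_pow (N s : ℕ) (hs : 0 < s) :
    (N.choose s : ℝ) ≤ (Real.exp 1 * N / s) ^ s := by
  have hs0 : (0 : ℝ) < s := by exact_mod_cast hs
  have hf : (0 : ℝ) < s.factorial := by exact_mod_cast s.factorial_pos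
  have h1 := Nat.choose_le_pow_div (α := ℝ) s N
  have h2 := Real.pow_div_factorial_le_exp (s : ℝ) hs0.le s
  rw [div_le_iff₀ hf] at h2
  have h3 : (1 : ℝ) / s.factorial ≤ (Real.exp 1 / s) ^ s := by
    rw [div_pow, ← Real.exp_nat_mul, mul_one, div_le_div_iff₀ hf (by positivity), one_mul]
    exact h2
  calc (N.choose s : ℝ) ≤ (N : ℝ) ^ s * (1 / s.factorial) := by rwa [mul_one_div]
    _ ≤ (N : ℝ) ^ s * (Real.exp 1 / s) ^ s := by gcongr
    _ = _ := by rw [← mul_pow]; congr 1; ring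

/-- Take b = ⌈s/k⌉. For s ≥ 2, k ≥ 3 gives 2b ≤ s; for s = 1 the powers are trivial. The last bound
lets the factor s^(2b) be absorbed by the s^s in the denominator of the binomial estimate. -/
theorem exists_ceil_div (hk : 3 ≤ k) {s : ℕ} (hs : 0 < s) :
    ∃ b, s ≤ k * b ∧ k * b < s + k ∧ b ≤ s ∧ s ^ (2 * b) ≤ s ^ s := by
  have h1 := Nat.div_add_mod (s + k - 1) k
  have h2 := Nat.mod_lt (s + k - 1) (show 0 < k by omega)
  set b := (s + k - 1) / k
  have h3 : s ≤ k * b := by omega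
  have h4 : k * b < s + k := by omega
  refine ⟨b, h3, h4, ?_, ?_⟩
  · by_contra! hlt
    have : k * (s + 1) ≤ k * b := Nat.mul_le_mul_left k hlt
    nlinarith
  · rcases Nat.lt_or_ge s 2 with h | h
    · obtain rfl : s = 1 := by omega
      simp
    · refine Nat.pow_le_pow_right hs ?_
      rcases Nat.lt_or_ge b 2 with hb | hb
      · omega
      · nlinarith

/-- Sets of size s contribute at most ρ^s in total, and the geometric series sums to at most 2ρ.
Taking μ as a k-th root turns the power b = ⌈s/k⌉ into a power s. -/
theorem prob_exists_isCoveredUnexpanded_le (hk : 3 ≤ k) (hn : 0 < n) {m : ℕ}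
    (hm : m ≤ Fintype.card (KEdge k n)) {μ ρ : ℝ} (hμ0 : 0 ≤ μ) (hμ1 : μ ≤ 1)
    (hμk : μ ^ k = 2 * m / n ^ 2)
    (hρ : Real.exp 1 * (k * n) * Real.exp (-((1 - 1 / (4 * k)) * (m / n))) * μ ≤ ρ)
    (hρ2 : ρ ≤ 1 / 2) :
    uniformProb (fun σ : EdgeOrder k n => ∃ S : Finset (KVertex k n), S.Nonempty ∧
      4 * k * S.card ≤ n ∧ IsCoveredUnexpanded (initialSet σ m) S) ≤ 2 * ρ := by
  set L : ℝ := (1 - 1 / (4 * k)) * (m / n) with hL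
  have hρ0 : 0 ≤ ρ := le_trans (by positivity) hρ
  have hterm : ∀ i ∈ Finset.range n, uniformProb (fun σ : EdgeOrder k n =>
      ∃ S ∈ (Finset.univ : Finset (KVertex k n)).powersetCard (i + 1),
        4 * k * (i + 1) ≤ n ∧ IsCoveredUnexpanded (initialSet σ m) S) ≤ ρ ^ (i + 1) := by
    intro i _
    set s := i + 1 with hs
    have hs0 : (0 : ℝ) < s := by positivity
    by_cases hsn : 4 * k * s ≤ n
    · obtain ⟨b, hb1, hb2, hb3, hb4⟩ := exists_ceil_div hk (Nat.succ_pos i)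
      have h1 := uniformProb_exists_mem_le_card_mul
        ((Finset.univ : Finset (KVertex k n)).powersetCard s)
        (fun S (σ : EdgeOrder k n) => 4 * k * s ≤ n ∧ IsCoveredUnexpanded (initialSet σ m) S)
        (c := ((s : ℝ) ^ 2 * (2 * m / n ^ 2)) ^ b * Real.exp (-(s * L))) fun S hS => by
          have hSc : S.card = s := (Finset.mem_powersetCard.1 hS).2
          have := prob_isCoveredUnexpanded_le (by omega) hn hm S (by rw [hSc]; exact hsn)
            (b := b) (by rw [hSc]; exact hb2) (by rw [hSc]; exact hb3)
          rw [hSc] at this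
          exact (uniformProb_mono fun σ h => h.2).trans this
      refine h1.trans ?_
      rw [Finset.card_powersetCard, Finset.card_univ, card_kVertex]
      have h2 : ((s : ℝ) ^ 2) ^ b ≤ (s : ℝ) ^ s := by
        rw [← pow_mul]; exact_mod_cast hb4
      have h3 : (2 * m / n ^ 2 : ℝ) ^ b ≤ μ ^ s := by
        rw [← hμk, ← pow_mul]
        exact pow_le_pow_of_le_one hμ0 hμ1 hb1
      have h4 : Real.exp (-(s * L)) = Real.exp (-L) ^ s := by
        rw [← Real.exp_nat_mul]; congr 1; ring
      calc (((k * n).choose s : ℕ) : ℝ)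
            * (((s : ℝ) ^ 2 * (2 * m / n ^ 2)) ^ b * Real.exp (-(s * L)))
          ≤ (Real.exp 1 * (k * n : ℕ) / s) ^ s * (((s : ℝ) ^ s * μ ^ s) * Real.exp (-L) ^ s) := by
            rw [h4, mul_pow]
            gcongr
            exact choose_le_exp_mul_div_pow _ _ (Nat.succ_pos i)
        _ = (Real.exp 1 * (k * n) * Real.exp (-L) * μ) ^ s := by
            rw [← mul_pow, ← mul_pow, ← mul_pow]
            congr 1
            push_cast
            field_simp
        _ ≤ ρ ^ s := by gcongr
    · refine le_trans (uniformProb_mono (q := fun _ => False) ?_) ?_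
      · rintro σ ⟨S, -, h, -⟩; exact hsn h
      · simp only [uniformProb, Finset.filter_false, Finset.card_empty, Nat.cast_zero, zero_div]
        positivity
  have hsum := (uniformProb_exists_mem_le (Finset.range n) _).trans (Finset.sum_le_sum hterm)
  refine (uniformProb_mono ?_).trans (hsum.trans ?_)
  · rintro σ ⟨S, hne, hS, hcov⟩
    have h1 : S.card ≤ n := by nlinarith
    have h2 : 0 < S.card := Finset.card_pos.2 hne
    have h3 : S.card - 1 + 1 = S.card := by omega
    refine ⟨S.card - 1, Finset.mem_range.2 (by omega), S, ?_, ?_, hcov⟩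
    · exact Finset.mem_powersetCard.2 ⟨Finset.subset_univ _, h3.symm⟩
    · rw [h3]; exact hS
  · simp only [pow_succ]
    rw [← Finset.sum_mul]
    gcongr
    have h1 : ρ < 1 := by linarith
    calc ∑ i ∈ Finset.range n, ρ ^ i ≤ ∑' i, ρ ^ i :=
          (summable_geometric_of_lt_one hρ0 h1).sum_le_tsum _ fun i _ => by positivity
      _ = (1 - ρ)⁻¹ := tsum_geometric_of_lt_one hρ0 h1
      _ ≤ 2 := by
          rw [inv_le_comm₀ (by linarith) (by norm_num)]
          linarith

theorem minDegreeAtLeast_one_iff {G : KSubgraph k n} :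
    G.MinDegreeAtLeast 1 ↔ ∀ v, ∃ e ∈ G, v ∈ e.verts := by
  refine forall_congr' fun v => ?_
  rw [KSubgraph.degree, Nat.one_le_iff_ne_zero, Ne, Finset.card_eq_zero,
    ← Ne, ← Finset.nonempty_iff_ne_empty, Finset.filter_nonempty_iff]

theorem rank_graph_hittingTime_eq {F : Type*} [Field F] (hk : 0 < k) (hn : 0 < n) {m M : ℕ}
    (σ : EdgeOrder k n)
    (h1 : ¬ ∃ x ∈ leftKernel F (initialSet σ m), n ^ k < 8 * k ^ 2 * (violatedEdges x).card)
    (h2 : ¬ ∃ S : Finset (KVertex k n), S.Nonempty ∧ 4 * k * S.card ≤ n ∧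
      IsCoveredUnexpanded (initialSet σ m) S)
    (h3 : ¬ ∀ v : KVertex k n, ∃ e ∈ initialSet σ m, v ∈ e.verts)
    (h4 : ¬ ∃ v : KVertex k n, ∀ e ∈ initialSet σ M, v ∉ e.verts)
    (h5 : ¬ ∃ t : Fin (Fintype.card (KEdge k n)),
        (m ≤ (t : ℕ) ∧ (t : ℕ) < M) ∧ ∃ v w : KVertex k n, v ≠ w ∧
          (∀ e ∈ initialSet σ m, v ∉ e.verts) ∧ (∀ e ∈ initialSet σ m, w ∉ e.verts) ∧
          v ∈ (σ t).verts ∧ w ∈ (σ t).verts) :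
    (((σ.graph (σ.hittingTime 1)).incidenceMatrix F).rank : ℤ)
      = (k : ℤ) * (n : ℤ) - ((k : ℤ) - 1) := by
  have hM : M ∈ {m : ℕ | (σ.graph m).MinDegreeAtLeast 1} := by
    push Not at h4
    exact minDegreeAtLeast_one_iff.2 h4
  have hcov := minDegreeAtLeast_one_iff.1 (Nat.sInf_mem ⟨M, hM⟩)
  have hle : σ.hittingTime 1 ≤ M := Nat.sInf_le hM
  have hge : m ≤ σ.hittingTime 1 := by
    by_contra! hlt
    refine h3 fun v => ?_
    obtain ⟨e, he, hv⟩ := hcov v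
    exact ⟨e, initialSet_mono σ hlt.le he, hv⟩
  refine rank_incidenceMatrix_eq hk hn (H := initialSet σ m) (initialSet_mono σ hge) ?_ ?_ hcov ?_
  · intro x hx
    by_contra! hlt
    exact h1 ⟨x, hx, hlt⟩
  · intro S hS hSn hSc
    by_contra! hno
    exact h2 ⟨S, hS, hSn, hSc, Finset.disjoint_right.2 hno⟩
  · intro e he v hv w hw hvi hwi
    by_contra hvw
    have he' : ((σ.symm e : Fin _) : ℕ) < σ.hittingTime 1 := mem_initialSet.1 he
    refine h5 ⟨σ.symm e, ⟨?_, he'.trans_le hle⟩, v, w, hvw, hvi, hwi, ?_, ?_⟩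
    · by_contra! hlt
      exact hvi e (mem_initialSet.2 hlt) hv
    · rwa [Equiv.apply_symm_apply]
    · rwa [Equiv.apply_symm_apply]

theorem processProb_eq_ofReal (A : Set (EdgeOrder k n)) :
    processProb k n A = ENNReal.ofReal (uniformProb fun σ => σ ∈ A) := by
  classical
  rw [processProb, PMF.toOuterMeasure_uniformOfFintype_apply, uniformProb_eq_card,
    ENNReal.ofReal_div_of_pos (by exact_mod_cast Fintype.card_pos), ENNReal.ofReal_natCast,
    ENNReal.ofReal_natCast, Fintype.card_subtype]

/-- The failure probability is small once `log n` is large. -/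
theorem prob_rank_ne_le {F : Type*} [Field F] (hk : 3 ≤ k) (hL1 : 1 ≤ Real.log n)
    (hLn : 4 * Real.log n ≤ n - 2)
    (hρ : Real.exp 1 * k * (4 * (Real.log n * Real.exp (-(1 / 2 * Real.log n)))) ^ (1 / k : ℝ)
      ≤ 1 / 2) :
    uniformProb (fun σ : EdgeOrder k n =>
      ¬ (((σ.graph (σ.hittingTime 1)).incidenceMatrix F).rank : ℤ)
        = (k : ℤ) * (n : ℤ) - ((k : ℤ) - 1))
      ≤ 16 * k ^ 3 * (Real.log n)⁻¹
        + 2 * (Real.exp 1 * k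
          * (4 * (Real.log n * Real.exp (-(1 / 2 * Real.log n)))) ^ (1 / k : ℝ))
        + Real.exp 2 * Real.exp (-(1 / (4 * k) * Real.log n))
        + k * Real.exp (-(1 * Real.log n))
        + 6 * k ^ 2 * (Real.log n * Real.exp (-(3 / 8 * Real.log n))) := by
  set L := Real.log n with hL
  have hn0 : (0 : ℝ) < n := by linarith
  have hn6 : (6 : ℝ) ≤ n := by linarith
  have hn6' : 6 ≤ n := by exact_mod_cast hn6
  have hk3 : (3 : ℝ) ≤ k := by exact_mod_cast hk
  have hexpL : Real.exp L = n := Real.exp_log hn0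
  -- As c < 1, isolated vertices survive at stage m. The exponent for unexpanded sets is c², one c
  -- from m/n and one from the expansion loss, and c² ≥ 1 - 1/(2k): then n · n^(-c²) ≤ n^(1/(2k)) is
  -- beaten by the k-th root of 4 log n / n.
  set c : ℝ := 1 - 1 / (4 * k) with hc
  have hk12 : 1 / (4 * (k : ℝ)) ≤ 1 / 12 := by
    apply one_div_le_one_div_of_le <;> linarith
  have hkpos : 0 < 1 / (4 * (k : ℝ)) := by positivity
  have hc1 : c ≤ 1 := by linarith
  have hc2 : 11 / 12 ≤ c := by linarith
  set m := ⌈c * n * L⌉₊ with hm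
  set M := ⌈2 * n * L⌉₊ with hM
  have hm1 : c * n * L ≤ m := Nat.le_ceil _
  have hm2 : (m : ℝ) ≤ c * n * L + 1 := (Nat.ceil_lt_add_one (by positivity)).le
  have hM1 : 2 * n * L ≤ M := Nat.le_ceil _
  have hM2 : (M : ℝ) ≤ 2 * n * L + 1 := (Nat.ceil_lt_add_one (by positivity)).le
  have hnL : 1 ≤ n * L := by nlinarith
  have hcn : c * n * L ≤ n * L := by
    calc c * n * L = c * (n * L) := by ring
      _ ≤ 1 * (n * L) := by gcongr
      _ = _ := one_mul _
  have hm3 : (m : ℝ) ≤ 2 * (n * L) := by linarith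
  have hM3 : (M : ℝ) ≤ 3 * (n * L) := by linarith
  have hnLn : 4 * (n * L) ≤ (n : ℝ) ^ 2 := by nlinarith
  have hmsq : 2 * m ≤ n ^ 2 := by
    have : 2 * (m : ℝ) ≤ (n : ℝ) ^ 2 := by linarith
    exact_mod_cast this
  have hMsq : M ≤ n ^ 2 := by
    have : (M : ℝ) ≤ (n : ℝ) ^ 2 := by linarith
    exact_mod_cast this
  have hp1 : n ^ 2 ≤ n ^ (k - 1) := Nat.pow_le_pow_right (by omega) (by omega)
  have hp2 : n ^ 2 ≤ n ^ k := Nat.pow_le_pow_right (by omega) (by omega)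
  have hmN : m ≤ Fintype.card (KEdge k n) := by rw [card_kEdge]; omega
  have hMN : M ≤ Fintype.card (KEdge k n) := by rw [card_kEdge]; omega
  have hmn : c * L ≤ m / n := by rw [le_div_iff₀ hn0]; linarith
  have hMn : 2 * L ≤ M / n := by rw [le_div_iff₀ hn0]; linarith
  have hm0 : (0 : ℝ) < m := lt_of_lt_of_le (by positivity) hm1
  have e1 : uniformProb (fun σ : EdgeOrder k n =>
      ∃ x ∈ leftKernel F (initialSet σ m), n ^ k < 8 * k ^ 2 * (violatedEdges x).card)
      ≤ 16 * k ^ 3 * L⁻¹ := by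
    have h := mul_prob_exists_violated_le (k := k) (n := n) (F := F) (by omega) hmN
    rw [mul_comm, ← le_div_iff₀ hm0] at h
    refine h.trans ?_
    rw [← div_eq_mul_inv, div_le_div_iff₀ hm0 (by linarith)]
    have h2 : (n : ℝ) * L ≤ 2 * m := by
      have : 11 / 12 * (n * L) ≤ c * (n * L) := by gcongr
      linarith
    calc 8 * (k : ℝ) ^ 3 * n * L = 8 * (k : ℝ) ^ 3 * (n * L) := by ring
      _ ≤ 8 * (k : ℝ) ^ 3 * (2 * m) := by gcongr
      _ = _ := by ring
  have e2 : uniformProb (fun σ : EdgeOrder k n => ∃ S : Finset (KVertex k n), S.Nonempty ∧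
      4 * k * S.card ≤ n ∧ IsCoveredUnexpanded (initialSet σ m) S)
      ≤ 2 * (Real.exp 1 * k * (4 * (L * Real.exp (-(1 / 2 * L)))) ^ (1 / k : ℝ)) := by
    have hlam1 : (2 * m / n ^ 2 : ℝ) ≤ 1 := by
      rw [div_le_one (by positivity)]; exact_mod_cast hmsq
    have hlam2 : (2 * m / n ^ 2 : ℝ) ≤ 4 * L * Real.exp (-L) := by
      rw [Real.exp_neg, hexpL, ← div_eq_mul_inv, div_le_div_iff₀ (by positivity) hn0]
      calc 2 * (m : ℝ) * n ≤ 2 * (2 * (n * L)) * n := by gcongr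
        _ = _ := by ring
    refine prob_exists_isCoveredUnexpanded_le hk (by omega) hmN
      (μ := (2 * m / n ^ 2 : ℝ) ^ (1 / k : ℝ)) (by positivity)
      (Real.rpow_le_one (by positivity) hlam1 (by positivity)) ?_ ?_ hρ
    · rw [one_div, Real.rpow_inv_natCast_pow (by positivity) (by omega)]
    · have h1 : Real.exp (-(c * (m / n))) ≤ Real.exp (-L) * Real.exp (1 / 2 * L * (1 / k)) := by
        rw [← Real.exp_add, Real.exp_le_exp]
        have h2 : c * (c * L) ≤ c * (m / n) := by gcongr
        have h3 : (1 - 1 / (2 * k)) * L ≤ c * (c * L) := by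
          rw [← mul_assoc]
          gcongr
          have : 1 / (2 * (k : ℝ)) = 2 * (1 / (4 * k)) := by field_simp; norm_num
          rw [this, hc]
          linarith [sq_nonneg (1 / (4 * (k : ℝ))),
            show (1 - 1 / (4 * (k : ℝ))) * (1 - 1 / (4 * k))
              = 1 - 2 * (1 / (4 * k)) + (1 / (4 * (k : ℝ))) ^ 2 by ring]
        have h4 : 1 / 2 * L * (1 / k) = 1 / (2 * k) * L := by field_simp
        linarith
      -- The loss n^(1/(2k)) is moved inside the k-th root, where it cancels half of the decay
      -- n^(-1).
      have h2 : (4 * (L * Real.exp (-(1 / 2 * L)))) ^ (1 / k : ℝ)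
          = Real.exp (1 / 2 * L * (1 / k)) * (4 * L * Real.exp (-L)) ^ (1 / k : ℝ) := by
        rw [Real.exp_mul, ← Real.mul_rpow (by positivity) (by positivity)]
        congr 1
        rw [show -(1 / 2 * L) = 1 / 2 * L + -L by ring, Real.exp_add]
        ring
      calc _ ≤ Real.exp 1 * (k * n) * (Real.exp (-L) * Real.exp (1 / 2 * L * (1 / k)))
            * (4 * L * Real.exp (-L)) ^ (1 / k : ℝ) := by gcongr
        _ = Real.exp 1 * k * (n * Real.exp (-L)) * (Real.exp (1 / 2 * L * (1 / k))
            * (4 * L * Real.exp (-L)) ^ (1 / k : ℝ)) := by ring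
        _ = _ := by
            rw [h2, Real.exp_neg, hexpL, mul_inv_cancel₀ hn0.ne', mul_one]
        _ ≤ _ := le_rfl
  have e3 : uniformProb (fun σ : EdgeOrder k n =>
      ∀ v : KVertex k n, ∃ e ∈ initialSet σ m, v ∈ e.verts)
      ≤ Real.exp 2 * Real.exp (-(1 / (4 * k) * L)) := by
    refine (prob_no_isolated_le (by omega) (by omega) (by omega)).trans ?_
    have h1 : (m : ℝ) / (n - 2) ≤ c * L + 2 := by
      rw [div_le_iff₀ (by linarith)]
      have h2 : c * L ≤ 1 * L := by gcongr
      have h3 : (c * L + 2) * (n - 2) = c * n * L - 2 * (c * L) + 2 * n - 4 := by ring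
      linarith
    calc _ ≤ Real.exp (c * L + 2) / n := by gcongr
      _ = _ := by
          rw [← hexpL, ← Real.exp_sub, ← Real.exp_add, hc]
          congr 1
          ring
  have e4 : uniformProb (fun σ : EdgeOrder k n =>
      ∃ v : KVertex k n, ∀ e ∈ initialSet σ M, v ∉ e.verts) ≤ k * Real.exp (-(1 * L)) := by
    refine (prob_exists_isolated_le (by omega) (by omega) hMN).trans ?_
    calc (k : ℝ) * n * Real.exp (-(M / n)) ≤ k * n * Real.exp (-(2 * L)) := by gcongr
      _ = _ := by
          rw [← hexpL, mul_assoc, ← Real.exp_add]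
          congr 2
          ring
  have e5 := prob_edge_joins_isolated_le (k := k) (n := n) (m := m) (M := M) (by omega) (by omega)
    (by omega)
  have e5' : 2 * (k : ℝ) ^ 2 * M * Real.exp (-(3 / 2 * (m / n)))
      ≤ 6 * k ^ 2 * (L * Real.exp (-(3 / 8 * L))) := by
    -- Here 11/8 = (3/2)(11/12), using c ≥ 11/12; it exceeds 1, so the factor n from M is beaten.
    calc _ ≤ 2 * (k : ℝ) ^ 2 * (3 * (n * L)) * Real.exp (-(11 / 8 * L)) := by
          have h1 : 11 / 12 * L ≤ c * L := by gcongr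
          have h2 : 11 / 8 * L ≤ 3 / 2 * (m / n) := by linarith
          gcongr
      _ = 6 * k ^ 2 * (L * (Real.exp L * Real.exp (-(11 / 8 * L)))) := by rw [hexpL]; ring
      _ = _ := by
          rw [← Real.exp_add]
          congr 4
          ring
  refine (uniformProb_mono (q := fun σ : EdgeOrder k n => (((_ ∨ _) ∨ _) ∨ _) ∨ _) ?_).trans
    ((uniformProb_or_le _ _).trans (add_le_add ((uniformProb_or_le _ _).trans
      (add_le_add ((uniformProb_or_le _ _).trans (add_le_add ((uniformProb_or_le _ _).trans
      (add_le_add e1 e2)) e3)) e4)) (e5.trans e5')))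
  intro σ hσ
  by_contra hcon
  simp only [not_or] at hcon
  obtain ⟨⟨⟨⟨h1, h2⟩, h3⟩, h4⟩, h5⟩ := hcon
  exact hσ (rank_graph_hittingTime_eq (by omega) (by omega) σ h1 h2 h3 h4 h5)

theorem tendsto_mul_exp_neg_mul {a : ℝ} (ha : 0 < a) :
    Tendsto (fun x : ℝ => x * Real.exp (-(a * x))) atTop (𝓝 0) := by
  have h := tendsto_rpow_mul_exp_neg_mul_atTop_nhds_zero 1 a ha
  simpa [neg_mul] using h

theorem tendsto_exp_neg_mul {a : ℝ} (ha : 0 < a) :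
    Tendsto (fun x : ℝ => Real.exp (-(a * x))) atTop (𝓝 0) :=
  Real.tendsto_exp_neg_atTop_nhds_zero.comp (tendsto_id.const_mul_atTop ha)

end Assembly

theorem mainTheorem7 (k : ℕ) (hk : 3 ≤ k) (F : Type*) [Field F] :
    Tendsto
      (fun n : ℕ => processProb k n
        {σ : EdgeOrder k n |
          (((σ.graph (σ.hittingTime 1)).incidenceMatrix F).rank : ℤ)
            = (k : ℤ) * (n : ℤ) - ((k : ℤ) - 1)})
      atTop (𝓝 1) := by
  have hlog : Tendsto (fun n : ℕ => Real.log n) atTop atTop :=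
    Real.tendsto_log_atTop.comp tendsto_natCast_atTop_atTop
  have hkpos : (0 : ℝ) < 1 / k := by
    have : (3 : ℝ) ≤ k := by exact_mod_cast hk
    positivity
  have hroot : Tendsto (fun n : ℕ => Real.exp 1 * k
      * (4 * (Real.log n * Real.exp (-(1 / 2 * Real.log n)))) ^ (1 / k : ℝ)) atTop (𝓝 0) := by
    have h1 := (((tendsto_mul_exp_neg_mul (a := 1 / 2) (by norm_num)).comp hlog).const_mul 4
      ).rpow_const (p := (1 / k : ℝ)) (Or.inr hkpos.le)
    rw [mul_zero, Real.zero_rpow hkpos.ne'] at h1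
    simpa using h1.const_mul (Real.exp 1 * k)
  have herr := (((((tendsto_inv_atTop_zero.comp hlog).const_mul (16 * (k : ℝ) ^ 3)).add
    (hroot.const_mul 2)).add (((tendsto_exp_neg_mul (a := 1 / (4 * (k : ℝ))) (by
      have : (3 : ℝ) ≤ k := by exact_mod_cast hk
      positivity)).comp hlog).const_mul (Real.exp 2))).add
    (((tendsto_exp_neg_mul one_pos).comp hlog).const_mul (k : ℝ))).add
    (((tendsto_mul_exp_neg_mul (a := 3 / 8) (by norm_num)).comp hlog).const_mul
      (6 * (k : ℝ) ^ 2))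
  simp only [mul_zero, add_zero, Function.comp_def] at herr
  have hsub := herr.const_sub 1
  rw [sub_zero] at hsub
  have hLn : ∀ᶠ n : ℕ in atTop, 4 * Real.log n ≤ n - 2 := by
    have h1 : Tendsto (fun x : ℝ => Real.exp x / x ^ 1) atTop atTop :=
      Real.tendsto_exp_div_pow_atTop 1
    filter_upwards [(h1.comp hlog).eventually_ge_atTop 6, hlog.eventually_ge_atTop 1,
      eventually_gt_atTop 0] with n h2 h3 hn
    simp only [Function.comp, pow_one] at h2
    rw [Real.exp_log (by exact_mod_cast hn), le_div_iff₀ (by linarith)] at h2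
    linarith
  have hprob : Tendsto (fun n : ℕ => uniformProb fun σ : EdgeOrder k n =>
      (((σ.graph (σ.hittingTime 1)).incidenceMatrix F).rank : ℤ)
        = (k : ℤ) * (n : ℤ) - ((k : ℤ) - 1)) atTop (𝓝 1) := by
    refine tendsto_of_tendsto_of_tendsto_of_le_of_le' hsub tendsto_const_nhds ?_ ?_
    · filter_upwards [hlog.eventually_ge_atTop 1, hLn,
        hroot.eventually_le_const (show (0 : ℝ) < 1 / 2 by norm_num)] with n h1 h2 h3
      have h4 := prob_rank_ne_le (F := F) hk h1 h2 h3
      have h5 := uniformProb_add_not fun σ : EdgeOrder k n =>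
        (((σ.graph (σ.hittingTime 1)).incidenceMatrix F).rank : ℤ)
          = (k : ℤ) * (n : ℤ) - ((k : ℤ) - 1)
      linarith
    · refine Eventually.of_forall fun n => ?_
      have h5 := uniformProb_add_not fun σ : EdgeOrder k n =>
        (((σ.graph (σ.hittingTime 1)).incidenceMatrix F).rank : ℤ)
          = (k : ℤ) * (n : ℤ) - ((k : ℤ) - 1)
      have h6 := uniformProb_nonneg fun σ : EdgeOrder k n =>
        ¬ (((σ.graph (σ.hittingTime 1)).incidenceMatrix F).rank : ℤ)
          = (k : ℤ) * (n : ℤ) - ((k : ℤ) - 1)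
      linarith
  simp only [processProb_eq_ofReal, Set.mem_ofPred_eq]
  simpa using ENNReal.tendsto_ofReal hprob
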